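/- Let $G$ be a finite-dimensional real Lie group with Lie algebra $\mathfrak g=T_\epsilon G$ and let $\nabla^+$ be a left invariant smooth linear connection on $G$ with vanishing torsion and curvature. Let $H\subseteq G$ be a closed normal subgroup with Lie algebra $\mathfrak h=T_\epsilon H$ such that every right translation $R_h(g)=gh$, $h\in H$, is an affine transformation of $(G,\nabla^+)$. Give $G/H$ the manifold structure for which $\pi:G\to G/H$ is a smooth submersion. For $X\in\mathfrak g$ let $X^-$ be the right invariant vector field on $G$ with $X^-_\epsilon=X$, let $X^*=\pi_*X^-$ be the induced vector field on $G/H$, and let $X*Y=(\nabla^+_{X^-}Y^-)_\epsilon$. Then $G/H$ is a Lie group, and: 1. If $\mathfrak h$ is a right ideal of $(\mathfrak g,*)$, that is, $X*Y\in\mathfrak h$ for $X\in\mathfrak h$, $Y\in\mathfrak g$, there is exactly one smooth linear connection $\overline\nabla$ on $G/H$ with $\overline\nabla_{X^*}Y^*=\pi_*(\nabla^+_{X^-}Y^-)$ for all $X,Y\in\mathfrak g$. It is invariant under the action of $G$ on $G/H$, the projection $\pi:(G,\nabla^+)\to(G/H,\overline\nabla)$ is an affine map (if $X,Y$ are smooth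 vector fields on $G$ that are $\pi$-related to smooth vector fields $\overline X,\overline Y$ on $G/H$, then $\nabla^+_XY$ is $\pi$-related to $\overline\nabla_{\overline X}\overline Y$), and $\overline\nabla$ is left invariant on the Lie group $G/H$. 2. If $\mathfrak g=\mathfrak h\oplus\mathfrak m$ for a linear subspace $\mathfrak m$ with $\mathrm{Ad}_h(\mathfrak m)\subseteq\mathfrak m$ for all $h\in H$, let $X\cdot Y=(X*Y)_{\mathfrak m}$ for $X,Y\in\mathfrak m$, the component in $\mathfrak m$. There is exactly one smooth $G$-invariant linear connection $\overline\nabla$ on $G/H$ with $(\overline\nabla_{X^*}Y^*)_{\epsilon H}=\pi_{*,\epsilon}(X\cdot Y)$ for all $X,Y\in\mathfrak m$. It satisfies $(\overline\nabla_{X^*}Y^*)_{gH}=\pi_{*,g}\big((\nabla^+_{X^-}Y^-)_g\big)$ for all $X,Y\in\mathfrak m$ and all $g\in G$ with $\mathrm{Ad}_{g^{-1}}(\mathfrak m)\subseteq\mathfrak m$ (in particular for all $g\in H$), and $\overline\nabla$ is left invariant on the Lie group $G/H$. -/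

import Mathlib

open Manifold
open scoped ContDiff Topology

noncomputable section

namespace AffineLie

section Connections

variable {E : Type*} [NormedAddCommGroup E] [NormedSpace ℝ E]
  {A : Type*} [TopologicalSpace A] (I : ModelWithCorners ℝ E A)
  {M : Type*} [TopologicalSpace M] [ChartedSpace A M]
  {E' : Type*} [NormedAddCommGroup E'] [NormedSpace ℝ E']
  {A' : Type*} [TopologicalSpace A'] (I' : ModelWithCorners ℝ E' A')
  {M' : Type*} [TopologicalSpace M'] [ChartedSpace A' M']

/-- `X` is a smooth vector field on `M`. -/
def SmoothField [IsManifold I 1 M] (X : Π x : M, TangentSpace I x) : Prop :=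
  ContMDiff I I.tangent ∞ (fun x => (⟨x, X x⟩ : TangentBundle I M))

variable (M) in
/-- Linear connections on `M`: covariant derivatives on the tangent bundle.
For `D : Connection I M`, the vector `(D_X Y)(x)` is written `D Y x (X x)`. -/
abbrev Connection [IsManifold I 1 M] : Type _ :=
  CovariantDerivative I E (fun x : M => TangentSpace I x)

variable {I}

/-- `(D_X Y)(x)`. -/
def Connection.nabla [IsManifold I 1 M] (D : Connection I M)
    (X Y : Π x : M, TangentSpace I x) (x : M) : TangentSpace I x :=
  D Y x (X x)

/-- The connection maps smooth vector fields to smooth sections of `Hom(TM, TM)`. -/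
def Connection.IsSmooth [IsManifold I 1 M] (D : Connection I M) : Prop :=
  CovariantDerivative.ContMDiffCovariantDerivative D ∞

/-- The torsion `D_X Y - D_Y X - [X,Y]` vanishes. -/
def Connection.IsTorsionFree [IsManifold I 1 M] (D : Connection I M) : Prop :=
  ∀ X Y : Π x : M, TangentSpace I x, SmoothField I X → SmoothField I Y → ∀ x : M,
    D.nabla X Y x - D.nabla Y X x - VectorField.mlieBracket I X Y x = 0

/-- The curvature `D_X D_Y - D_Y D_X - D_[X,Y]` vanishes. -/
def Connection.IsFlat [IsManifold I 1 M] (D : Connection I M) : Prop :=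
  ∀ X Y Z : Π x : M, TangentSpace I x,
    SmoothField I X → SmoothField I Y → SmoothField I Z → ∀ x : M,
      D.nabla X (D.nabla Y Z) x - D.nabla Y (D.nabla X Z) x
        - D.nabla (VectorField.mlieBracket I X Y) Z x = 0

/-- A connection is flat affine if both its torsion and its curvature vanish. -/
def Connection.IsFlatAffine [IsManifold I 1 M] (D : Connection I M) : Prop :=
  D.IsTorsionFree ∧ D.IsFlat

variable (I) in
/-- The vector fields `X` and `X'` are `f`-related; for a diffeomorphism `f` this means
`X' = f_* X`. -/
def Related (f : M → M') (X : Π x : M, TangentSpace I x) (X' : Π y : M', TangentSpace I' y) :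
    Prop :=
  ∀ x : M, mfderiv I I' f x (X x) = X' (f x)

variable {I'} in
/-- `f` is an affine map from `(M, D)` to `(M', D')`: it is smooth, and
`f_* (D_X Y) = D'_{f_* X} (f_* Y)` for all smooth vector fields `X`, `Y` on `M` that have smooth
images `f_* X`, `f_* Y` on `M'` (for a diffeomorphism: for all smooth `X`, `Y`). -/
def IsAffineMap [IsManifold I 1 M] [IsManifold I' 1 M'] (D : Connection I M)
    (D' : Connection I' M') (f : M → M') : Prop :=
  ContMDiff I I' ∞ f ∧
  ∀ (X Y : Π x : M, TangentSpace I x) (X' Y' : Π y : M', TangentSpace I' y),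
    SmoothField I X → SmoothField I Y → SmoothField I' X' → SmoothField I' Y' →
    Related I I' f X X' → Related I I' f Y Y' →
    Related I I' f (D.nabla X Y) (D'.nabla X' Y')

/-- Two connections agree if they define the same derivative of every smooth vector field
(the value on non-differentiable fields carries no information). -/
def Connection.Agree [IsManifold I 1 M] (D D' : Connection I M) : Prop :=
  ∀ X Y : Π x : M, TangentSpace I x, SmoothField I X → SmoothField I Y →
    D.nabla X Y = D'.nabla X Y

/-- A connection on a group is left invariant if all left translations are affine. -/
def Connection.IsLeftInvariant {K : Type*} [TopologicalSpace K] [ChartedSpace A K] [Group K]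
    [IsManifold I 1 K] (D : Connection I K) : Prop :=
  ∀ k : K, IsAffineMap D D (fun x : K => k * x)

variable (M) in
/-- A connection on a `G`-space is `G`-invariant if every `g : G` acts by an affine map. -/
def Connection.IsInvariantUnder (G : Type*) [SMul G M] [IsManifold I 1 M]
    (D : Connection I M) : Prop :=
  ∀ g : G, IsAffineMap D D (fun x : M => g • x)

end Connections

section Groups

variable {E : Type*} [NormedAddCommGroup E] [NormedSpace ℝ E]
  {A : Type*} [TopologicalSpace A] {I : ModelWithCorners ℝ E A}
  {G : Type*} [TopologicalSpace G] [ChartedSpace A G] [Group G]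

/-- The right invariant vector field `X⁻` with value `X` at the identity. -/
def rightField (X : GroupLieAlgebra I G) (g : G) : TangentSpace I g :=
  mfderiv I I (fun x : G => x * g) (1 : G) X

/-- The adjoint map `Ad_g`. -/
def adjoint (g : G) (X : GroupLieAlgebra I G) : GroupLieAlgebra I G :=
  mfderiv I I (fun x : G => g * x * g⁻¹) (1 : G) X

/-- The product `X * Y = (D_{X⁻} Y⁻)(1)` on the Lie algebra of `G`. -/
def starProd [IsManifold I 1 G] (D : Connection I G) (X Y : GroupLieAlgebra I G) :
    GroupLieAlgebra I G :=
  D.nabla (rightField X) (rightField Y) (1 : G)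

/-- `v` is the velocity at time `0` of a smooth curve through `1` that stays in `H`. -/
def IsTangentAtOne (H : Subgroup G) (v : GroupLieAlgebra I G) : Prop :=
  ∃ γ : ℝ → G, ContMDiff 𝓘(ℝ, ℝ) I ∞ γ ∧ (∀ t, γ t ∈ H) ∧ γ 0 = 1 ∧
    (mfderiv 𝓘(ℝ, ℝ) I γ 0 (1 : ℝ) : E) = v

variable {F : Type*} [NormedAddCommGroup F] [NormedSpace ℝ F]
  {B : Type*} [TopologicalSpace B] (J : ModelWithCorners ℝ F B)
  {H : Subgroup G} [ChartedSpace B (G ⧸ H)]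

/-- The vector field `X^* = π_* X⁻` on `G ⧸ H`, i.e. the field generating the action of the
one-parameter group of `X`: its value at `x` is the derivative of `g ↦ g • x` at `1` along `X`. -/
def projField (X : GroupLieAlgebra I G) (x : G ⧸ H) : TangentSpace J x :=
  mfderiv I J (fun g : G => g • x) (1 : G) X

end Groups

section LieSubalgebra

variable {E : Type*} [NormedAddCommGroup E] [NormedSpace ℝ E]
  {A : Type*} [TopologicalSpace A] {I : ModelWithCorners ℝ E A}
  {G : Type*} [TopologicalSpace G] [ChartedSpace A G] [Group G]

lemma isTangentAtOne_zero (H : Subgroup G) : IsTangentAtOne (I := I) H 0 := by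
  refine ⟨fun _ => 1, contMDiff_const, fun _ => H.one_mem, rfl, ?_⟩
  rw [mfderiv_const]
  rfl

lemma IsTangentAtOne.add [LieGroup I ∞ G] {H : Subgroup G} {v w : GroupLieAlgebra I G}
    (hv : IsTangentAtOne H v) (hw : IsTangentAtOne H w) : IsTangentAtOne H (v + w) := by
  obtain ⟨γ, hγ, hγH, hγ0, rfl⟩ := hv
  obtain ⟨δ, hδ, hδH, hδ0, rfl⟩ := hw
  refine ⟨fun t => γ t * δ t, hγ.mul hδ, fun t => H.mul_mem (hγH t) (hδH t), by simp [hγ0, hδ0], ?_⟩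
  have h1 : MDifferentiableAt 𝓘(ℝ, ℝ) I γ 0 := hγ.mdifferentiableAt (by simp)
  have h2 : MDifferentiableAt 𝓘(ℝ, ℝ) I δ 0 := hδ.mdifferentiableAt (by simp)
  have hm : MDifferentiableAt (I.prod I) I (fun p : G × G => p.1 * p.2) (γ 0, δ 0) :=
    (contMDiff_mul I ∞).mdifferentiableAt (by simp)
  have hc := mfderiv_comp (I := 𝓘(ℝ, ℝ)) (I' := I.prod I) (I'' := I) (0 : ℝ)
    (g := fun p : G × G => p.1 * p.2) (f := fun t => (γ t, δ t)) hm (h1.prodMk h2)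
  have key : ∀ u : TangentSpace 𝓘(ℝ, ℝ) (0 : ℝ),
      (mfderiv 𝓘(ℝ, ℝ) I (fun t => γ t * δ t) 0 u : E)
        = @HAdd.hAdd E E E _ (mfderiv 𝓘(ℝ, ℝ) I γ 0 u) (mfderiv 𝓘(ℝ, ℝ) I δ 0 u) := by
    intro u
    have e : mfderiv 𝓘(ℝ, ℝ) I (fun t => γ t * δ t) 0 u =
        mfderiv (I.prod I) I (fun p : G × G => p.1 * p.2) (γ 0, δ 0)
          (mfderiv 𝓘(ℝ, ℝ) I γ 0 u, mfderiv 𝓘(ℝ, ℝ) I δ 0 u) := by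
      have := congrArg (fun L => L u) hc
      refine this.trans ?_
      rw [mfderiv_prodMk h1 h2]
      rfl
    refine e.trans ((mfderiv_prod_eq_add_apply hm).trans ?_)
    have k1 : ∀ (a b : G) (z : E), b = 1 →
        (mfderiv I I (fun x : G => x * b) a z : E) = z := by
      rintro a b z rfl
      have : HasMFDerivAt I I (fun x : G => x * 1) a (ContinuousLinearMap.id ℝ E) :=
        (hasMFDerivAt_id a).congr_of_eventuallyEq (Filter.Eventually.of_forall fun x => mul_one x)
      exact congrArg (fun L => L z) this.mfderiv
    have k2 : ∀ (a b : G) (z : E), a = 1 →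
        (mfderiv I I (fun x : G => a * x) b z : E) = z := by
      rintro a b z rfl
      have : HasMFDerivAt I I (fun x : G => 1 * x) b (ContinuousLinearMap.id ℝ E) :=
        (hasMFDerivAt_id b).congr_of_eventuallyEq (Filter.Eventually.of_forall fun x => one_mul x)
      exact congrArg (fun L => L z) this.mfderiv
    exact congrArg₂ (fun x y : E => x + y) (k1 _ _ _ hδ0) (k2 _ _ _ hγ0)
  exact key _

lemma IsTangentAtOne.smul {H : Subgroup G} {v : GroupLieAlgebra I G} (c : ℝ)
    (hv : IsTangentAtOne H v) : IsTangentAtOne H (c • v) := by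
  obtain ⟨γ, hγ, hγH, hγ0, rfl⟩ := hv
  have hs : ContMDiff 𝓘(ℝ, ℝ) 𝓘(ℝ, ℝ) ∞ (fun t : ℝ => t * c) :=
    (contDiff_id.mul contDiff_const).contMDiff
  refine ⟨fun t => γ (t * c), hγ.comp hs, fun t => hγH _, by simp [hγ0], ?_⟩
  have hc := mfderiv_comp_of_eq (I := 𝓘(ℝ, ℝ)) (I' := 𝓘(ℝ, ℝ)) (I'' := I) (x := (0 : ℝ))
    (g := γ) (f := fun t : ℝ => t * c) (y := 0) (hγ.mdifferentiableAt (by simp))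
    (hs.mdifferentiableAt (by simp)) (by simp)
  have hd : ∀ u : ℝ, (mfderiv 𝓘(ℝ, ℝ) 𝓘(ℝ, ℝ) (fun t : ℝ => t * c) 0 u : ℝ) = c * u := by
    intro u
    rw [mfderiv_eq_fderiv]
    have : HasFDerivAt (fun t : ℝ => t * c) (c • ContinuousLinearMap.id ℝ ℝ) (0 : ℝ) := by
      simpa using (hasFDerivAt_id (𝕜 := ℝ) (0 : ℝ)).mul_const c
    exact congrArg (fun L => L u) this.fderiv
  have h0 : ∀ (a : ℝ) (z : ℝ), a = 0 →
      (mfderiv 𝓘(ℝ, ℝ) I γ a z : E) = mfderiv 𝓘(ℝ, ℝ) I γ 0 z := by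
    rintro a z rfl
    rfl
  have hc' : (mfderiv 𝓘(ℝ, ℝ) I (fun t => γ (t * c)) 0 (1 : ℝ) : E) =
      mfderiv 𝓘(ℝ, ℝ) I γ 0 (mfderiv 𝓘(ℝ, ℝ) 𝓘(ℝ, ℝ) (fun t : ℝ => t * c) 0 (1 : ℝ) : ℝ) :=
    (congrArg (fun L => L (1 : ℝ)) hc).trans (h0 _ _ (by simp))
  refine hc'.trans ?_
  rw [hd 1]
  exact ((mfderiv 𝓘(ℝ, ℝ) I γ 0 : ℝ →L[ℝ] E).map_smul c 1)

variable (I) in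
/-- The Lie algebra `T_1 H` of a closed subgroup `H` of a Lie group `G`, as a subspace of the
Lie algebra of `G`. -/
def subLie [LieGroup I ∞ G] (H : Subgroup G) : Submodule ℝ (GroupLieAlgebra I G) where
  carrier := {v | IsTangentAtOne H v}
  zero_mem' := isTangentAtOne_zero H
  add_mem' := IsTangentAtOne.add
  smul_mem' c _ := IsTangentAtOne.smul c

end LieSubalgebra

section Induced

variable {E : Type*} [NormedAddCommGroup E] [NormedSpace ℝ E]
  {A : Type*} [TopologicalSpace A] {I : ModelWithCorners ℝ E A}
  {G : Type*} [TopologicalSpace G] [ChartedSpace A G] [Group G] [LieGroup I ∞ G]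
  {F : Type*} [NormedAddCommGroup F] [NormedSpace ℝ F]
  {B : Type*} [TopologicalSpace B] {J : ModelWithCorners ℝ F B}
  {H : Subgroup G} [ChartedSpace B (G ⧸ H)] [IsManifold J 1 (G ⧸ H)]

/-- A subspace `V` of the Lie algebra is a right ideal for the product `*`: `V * 𝔤 ⊆ V`. -/
def IsStarRightIdeal (D : Connection I G) (V : Submodule ℝ (GroupLieAlgebra I G)) : Prop :=
  ∀ X ∈ V, ∀ Y : GroupLieAlgebra I G, starProd D X Y ∈ V

variable (I) in
/-- `𝔪` is a reductive complement for `G ⧸ H`: `𝔤 = 𝔥 ⊕ 𝔪` and `Ad_h 𝔪 ⊆ 𝔪` for `h ∈ H`. -/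
structure IsReductiveComplement (H : Subgroup G) (m : Submodule ℝ (GroupLieAlgebra I G)) :
    Prop where
  isCompl : IsCompl m (subLie I H)
  adjoint_mem : ∀ h ∈ H, ∀ X ∈ m, adjoint (I := I) h X ∈ m

/-- The product `X · Y = (X * Y)_𝔪` on a reductive complement. -/
def reductiveProd (D : Connection I G) {m : Submodule ℝ (GroupLieAlgebra I G)}
    (hm : IsReductiveComplement I H m) (X Y : m) : m :=
  m.projectionOnto (subLie I H) hm.isCompl (starProd D X Y)

/-- The formula `D'_{X^*} Y^* = π_* (D_{X⁻} Y⁻)` at the point `π g`. -/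
def InducedAt (D : Connection I G) (D' : Connection J (G ⧸ H)) (X Y : GroupLieAlgebra I G)
    (g : G) : Prop :=
  D'.nabla (projField J X) (projField J Y) (g : G ⧸ H) =
    mfderiv I J (fun x : G => (x : G ⧸ H)) g (D.nabla (rightField X) (rightField Y) g)

/-- The product on `𝔪` is the one that `D'` defines at the base point of `G ⧸ H`:
`(D'_{X^*} Y^*)(π 1) = π_* (X · Y)` for `X, Y ∈ 𝔪`. -/
def HasReductiveProd (D : Connection I G) {m : Submodule ℝ (GroupLieAlgebra I G)}
    (hm : IsReductiveComplement I H m) (D' : Connection J (G ⧸ H)) : Prop :=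
  ∀ X Y : m, D'.nabla (projField J (X : GroupLieAlgebra I G)) (projField J (Y : GroupLieAlgebra I G))
      ((1 : G) : G ⧸ H) =
    mfderiv I J (fun x : G => (x : G ⧸ H)) 1 (reductiveProd D hm X Y : GroupLieAlgebra I G)

end Induced

end AffineLie

end

open AffineLie

/-! In the left trivialization a left invariant connection is differentiation of components plus a
constant bilinear product C on the Lie algebra: `leftConn`, with `leftProd` recovering C
(`agree_leftConn`). A homomorphism, such as the projection π with differential p at the identity,
acts on left components by p alone. So π carries one such connection to another at g as soon as p
intertwines the two products on the left components of the fields at g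
(`leftConn_nabla_of_related`). Both connections on the quotient are `leftConn` of p C(s·, s·), where
s is a linear section of p; they are left invariant, which is the same as G-invariant because G acts
through left translations of G/H.

The product X * Y equals C(X, Y) plus a term that does not involve the connection (`starProd_eq`)
and that descends along π (`tmap_starProd`). Now 𝔥 is the kernel of p (`mem_subLie_iff`). If it is a
right ideal for *, then C(𝔥, 𝔤) ⊆ 𝔥; vanishing torsion and the fact that 𝔥 is a Lie ideal give C(𝔤,
𝔥) ⊆ 𝔥. Hence C descends, whatever s is. In the reductive case s takes values in 𝔪 and inverts p
there. The right invariant field of X has left component Ad_{g⁻¹} X at g, so the formula holds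
wherever Ad_{g⁻¹} preserves 𝔪.

Uniqueness is tensoriality in the first case, since projected fields span every tangent space. In
the second, a left invariant connection is determined by its product * on the quotient, and p maps 𝔪
onto the quotient algebra. -/

namespace AffineLie

/-! ### Derivatives between model spaces and coordinates on the tangent bundle. -/

section TangentMap

variable {E : Type*} [NormedAddCommGroup E] [NormedSpace ℝ E]
  {E' : Type*} [NormedAddCommGroup E'] [NormedSpace ℝ E']
  {E'' : Type*} [NormedAddCommGroup E''] [NormedSpace ℝ E'']
  {M : Type*} [TopologicalSpace M] [ChartedSpace E M]
  {M' : Type*} [TopologicalSpace M'] [ChartedSpace E' M']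
  {M'' : Type*} [TopologicalSpace M''] [ChartedSpace E'' M'']

variable (E E') in
/-- The derivative of a map between manifolds, as a map between the model spaces. -/
noncomputable def tmap (f : M → M') (x : M) : E →L[ℝ] E' :=
  mfderiv 𝓘(ℝ, E) 𝓘(ℝ, E') f x

lemma tmap_id (x : M) : tmap E E (fun y : M => y) x = ContinuousLinearMap.id ℝ E :=
  mfderiv_id

lemma tmap_const (c : M') (x : M) : tmap E E' (fun _ : M => c) x = (0 : E →L[ℝ] E') :=
  mfderiv_const

lemma tmap_comp {g : M' → M''} {f : M → M'} {x : M}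
    (hg : MDifferentiableAt 𝓘(ℝ, E') 𝓘(ℝ, E'') g (f x))
    (hf : MDifferentiableAt 𝓘(ℝ, E) 𝓘(ℝ, E') f x) :
    tmap E E'' (fun y => g (f y)) x = tmap E' E'' g (f x) ∘L tmap E E' f x :=
  mfderiv_comp x hg hf

/-- The middle point is a free variable because in a group `f x` is often only propositionally equal
to the point wanted, for example `k⁻¹ * k` and `1`. -/
lemma tmap_comp_apply {g : M' → M''} {f : M → M'} {x : M} {y : M'} (hy : f x = y)
    (hg : MDifferentiableAt 𝓘(ℝ, E') 𝓘(ℝ, E'') g y)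
    (hf : MDifferentiableAt 𝓘(ℝ, E) 𝓘(ℝ, E') f x) (v : E) :
    tmap E E'' (fun z => g (f z)) x v = tmap E' E'' g y (tmap E E' f x v) := by
  subst hy
  rw [tmap_comp hg hf]
  rfl

lemma tmap_congr {f g : M → M'} {x : M} (h : f =ᶠ[𝓝 x] g) :
    tmap E E' f x = tmap E E' g x :=
  h.mfderiv_eq

lemma tmap_eq_fderiv (f : E → E') (x : E) : tmap E E' f x = fderiv ℝ f x :=
  mfderiv_eq_fderiv

lemma tmap_clm_comp (L : E' →L[ℝ] E'') {f : M → E'} {x : M}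
    (hf : MDifferentiableAt 𝓘(ℝ, E) 𝓘(ℝ, E') f x) :
    tmap E E'' (fun y => L (f y)) x = L ∘L tmap E E' f x := by
  have h := tmap_comp (E := E) (E' := E') (E'' := E'') (g := fun y => L y) (f := f) (x := x)
    L.differentiableAt.mdifferentiableAt hf
  rw [h, tmap_eq_fderiv, L.fderiv]

lemma tmap_add {f g : M → E'} {x : M} (hf : MDifferentiableAt 𝓘(ℝ, E) 𝓘(ℝ, E') f x)
    (hg : MDifferentiableAt 𝓘(ℝ, E) 𝓘(ℝ, E') g x) :
    tmap E E' (fun y => f y + g y) x = tmap E E' f x + tmap E E' g x :=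
  (hf.hasMFDerivAt.add hg.hasMFDerivAt).mfderiv

lemma tmap_smul {f : M → ℝ} {g : M → E'} {x : M} (hf : MDifferentiableAt 𝓘(ℝ, E) 𝓘(ℝ, ℝ) f x)
    (hg : MDifferentiableAt 𝓘(ℝ, E) 𝓘(ℝ, E') g x) :
    tmap E E' (fun y => f y • g y) x
      = f x • tmap E E' g x + (tmap E ℝ f x).smulRight (g x) := by
  have h : HasMFDerivAt 𝓘(ℝ, E) 𝓘(ℝ, E') (fun y => f y • g y) x
      (f x • tmap E E' g x + (tmap E ℝ f x).smulRight (g x)) := by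
    refine ⟨hf.continuousAt.smul hg.continuousAt, ?_⟩
    have h := hf.hasMFDerivAt.2.smul hg.hasMFDerivAt.2
    -- The product rule in charts evaluates `f` and `g` at the chart round trip of `x`.
    have e : (extChartAt 𝓘(ℝ, E) x).symm (extChartAt 𝓘(ℝ, E) x x) = x := extChartAt_to_inv x
    refine h.congr_fderiv ?_
    change f ((extChartAt 𝓘(ℝ, E) x).symm (extChartAt 𝓘(ℝ, E) x x)) • _
      + ContinuousLinearMap.smulRight _ (g ((extChartAt 𝓘(ℝ, E) x).symm _)) = _
    rw [e]
    rfl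
  exact h.mfderiv

variable [IsManifold 𝓘(ℝ, E) 1 M]

variable (E) in
/-- The change of coordinates from the chart at `x` to the chart at `x₀`. -/
noncomputable def toCoord (x₀ x : M) : E →L[ℝ] E := tangentCoordChange 𝓘(ℝ, E) x x₀ x

variable (E) in
/-- The change of coordinates from the chart at `x₀` to the chart at `x`. -/
noncomputable def ofCoord (x₀ x : M) : E →L[ℝ] E := tangentCoordChange 𝓘(ℝ, E) x₀ x x

lemma ofCoord_toCoord {x₀ x : M} (hx : x ∈ (chartAt E x₀).source) (v : E) :
    ofCoord E x₀ x (toCoord E x₀ x v) = v := by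
  have h1 : x ∈ (extChartAt 𝓘(ℝ, E) x₀).source := by simpa using hx
  have h2 : x ∈ (extChartAt 𝓘(ℝ, E) x).source := mem_extChartAt_source x
  exact (tangentCoordChange_comp ⟨⟨h2, h1⟩, h2⟩).trans (tangentCoordChange_self h2)

lemma toCoord_self (x : M) : toCoord E x x = ContinuousLinearMap.id ℝ E := by
  ext v
  exact tangentCoordChange_self (mem_extChartAt_source x)

lemma ofCoord_self (x : M) : ofCoord E x x = ContinuousLinearMap.id ℝ E := by
  ext v
  exact tangentCoordChange_self (mem_extChartAt_source x)

lemma toCoord_model (x₀ x : E) : toCoord E x₀ x = ContinuousLinearMap.id ℝ E := by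
  ext v
  exact congrArg (fun L : E →L[ℝ] E => L v) (tangentBundleCore_coordChange_model_space (I := 𝓘(ℝ, E)) _ _ _)

lemma toCoord_eq_tmap {x₀ x : M} (hx : x ∈ (chartAt E x₀).source) :
    toCoord E x₀ x = tmap E E (chartAt E x₀) x :=
  (mfderiv_chartAt_eq_tangentCoordChange (I := 𝓘(ℝ, E)) hx).symm

lemma contMDiffAt_section_iff {n : WithTop ℕ∞} {X : Π x : M, TangentSpace 𝓘(ℝ, E) x} {x₀ : M} :
    ContMDiffAt 𝓘(ℝ, E) 𝓘(ℝ, E).tangent n (fun x => (⟨x, X x⟩ : TangentBundle 𝓘(ℝ, E) M)) x₀ ↔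
      ContMDiffAt 𝓘(ℝ, E) 𝓘(ℝ, E) n (fun x => toCoord E x₀ x (X x)) x₀ :=
  Bundle.contMDiffAt_section (IB := 𝓘(ℝ, E)) x₀

lemma mdifferentiableAt_section_iff {X : Π x : M, TangentSpace 𝓘(ℝ, E) x} {x₀ : M} :
    MDifferentiableAt 𝓘(ℝ, E) 𝓘(ℝ, E).tangent
      (fun x => (⟨x, X x⟩ : TangentBundle 𝓘(ℝ, E) M)) x₀ ↔
      MDifferentiableAt 𝓘(ℝ, E) 𝓘(ℝ, E) (fun x => toCoord E x₀ x (X x)) x₀ :=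
  mdifferentiableAt_section (IB := 𝓘(ℝ, E)) (F := E) X

lemma contMDiffAt_homSection_iff {n : WithTop ℕ∞}
    {A : Π x : M, TangentSpace 𝓘(ℝ, E) x →L[ℝ] TangentSpace 𝓘(ℝ, E) x} {x₀ : M} :
    ContMDiffAt 𝓘(ℝ, E) (𝓘(ℝ, E).prod 𝓘(ℝ, E →L[ℝ] E)) n
      (fun x => (⟨x, A x⟩ : Bundle.TotalSpace (E →L[ℝ] E)
        fun x : M => TangentSpace 𝓘(ℝ, E) x →L[ℝ] TangentSpace 𝓘(ℝ, E) x)) x₀ ↔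
      ContMDiffAt 𝓘(ℝ, E) 𝓘(ℝ, E →L[ℝ] E) n
        (fun x => toCoord E x₀ x ∘L (A x : E →L[ℝ] E) ∘L ofCoord E x₀ x) x₀ := by
  rw [contMDiffAt_hom_bundle]
  refine (and_iff_right contMDiffAt_id).trans ?_
  refine Filter.EventuallyEq.contMDiffAt_iff ?_
  filter_upwards [(chartAt E x₀).open_source.mem_nhds (mem_chart_source E x₀)] with x hx
  exact inTangentCoordinates_eq (I := 𝓘(ℝ, E)) (I' := 𝓘(ℝ, E)) id id
    (fun x => (A x : E →L[ℝ] E)) hx hx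

end TangentMap

/-! ### Smooth dependence of partial derivatives on parameters. -/

section ParametricTangentMap

variable {E : Type*} [NormedAddCommGroup E] [NormedSpace ℝ E]
  {E' : Type*} [NormedAddCommGroup E'] [NormedSpace ℝ E']
  {E'' : Type*} [NormedAddCommGroup E''] [NormedSpace ℝ E'']
  {M : Type*} [TopologicalSpace M] [ChartedSpace E M] [IsManifold 𝓘(ℝ, E) ∞ M]
  {M' : Type*} [TopologicalSpace M'] [ChartedSpace E' M'] [IsManifold 𝓘(ℝ, E') ∞ M']
  {N : Type*} [TopologicalSpace N] [ChartedSpace E'' N] [IsManifold 𝓘(ℝ, E'') ∞ N]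

/-- The partial derivative of a smooth map is smooth, in coordinates. -/
lemma contMDiffAt_tmap {f : N → M → M'} {g : N → M} {x₀ : N}
    (hf : ContMDiffAt (𝓘(ℝ, E'').prod 𝓘(ℝ, E)) 𝓘(ℝ, E') ∞ (Function.uncurry f) (x₀, g x₀))
    (hg : ContMDiffAt 𝓘(ℝ, E'') 𝓘(ℝ, E) ∞ g x₀) :
    ContMDiffAt 𝓘(ℝ, E'') 𝓘(ℝ, E →L[ℝ] E') ∞
      (fun x => toCoord E' (f x₀ (g x₀)) (f x (g x)) ∘L tmap E E' (f x) (g x)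
        ∘L ofCoord E (g x₀) (g x)) x₀ := by
  have h := ContMDiffAt.mfderiv (m := ∞) f g hf hg (by simp)
  refine (Filter.EventuallyEq.contMDiffAt_iff ?_).1 h
  have hfg : ContinuousAt (fun x => f x (g x)) x₀ :=
    ContinuousAt.comp (f := fun x => (x, g x)) (g := Function.uncurry f) hf.continuousAt
      (continuousAt_id.prodMk hg.continuousAt)
  filter_upwards [hg.continuousAt.preimage_mem_nhds
      ((chartAt E (g x₀)).open_source.mem_nhds (mem_chart_source E (g x₀))),
    hfg.preimage_mem_nhds ((chartAt E' (f x₀ (g x₀))).open_source.mem_nhds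
      (mem_chart_source E' (f x₀ (g x₀))))] with x hx hx'
  exact inTangentCoordinates_eq (I := 𝓘(ℝ, E)) (I' := 𝓘(ℝ, E')) g (fun x => f x (g x))
    (fun x => tmap E E' (f x) (g x)) hx hx'

end ParametricTangentMap

/-! ### Left trivialization and the connections defined by bilinear products. -/

section LieGroup

variable {F : Type*} [NormedAddCommGroup F] [NormedSpace ℝ F]
  {K : Type*} [TopologicalSpace K] [ChartedSpace F K] [Group K]

variable (F) in
/-- The left Maurer-Cartan form. -/
noncomputable def leftForm (k : K) : F →L[ℝ] F := tmap F F (fun x : K => k⁻¹ * x) k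

variable (F) in
/-- The derivative at `1` of the left translation by `k`. -/
noncomputable def leftTrans (k : K) : F →L[ℝ] F := tmap F F (fun x : K => k * x) 1

variable (F) in
/-- The derivative at `1` of the right translation by `k`. -/
noncomputable def rightTrans (k : K) : F →L[ℝ] F := tmap F F (fun x : K => x * k) 1

/-- The components of a vector field in the left trivialization of the tangent bundle. -/
noncomputable def leftCoord (Y : Π k : K, TangentSpace 𝓘(ℝ, F) k) (k : K) : F :=
  leftForm F k (Y k)

/-- The left invariant vector field with value `v` at `1`. -/
noncomputable def leftField (v : F) (k : K) : TangentSpace 𝓘(ℝ, F) k := leftTrans F k v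

lemma leftTrans_one : leftTrans F (1 : K) = ContinuousLinearMap.id ℝ F := by
  have : (fun x : K => 1 * x) = fun x => x := by ext; simp
  rw [leftTrans, this, tmap_id]

lemma leftForm_one : leftForm F (1 : K) = ContinuousLinearMap.id ℝ F := by
  have : (fun x : K => 1⁻¹ * x) = fun x => x := by ext; simp
  rw [leftForm, this, tmap_id]

lemma rightTrans_one : rightTrans F (1 : K) = ContinuousLinearMap.id ℝ F := by
  have : (fun x : K => x * 1) = fun x => x := by ext; simp
  rw [rightTrans, this, tmap_id]

lemma leftField_add (v w : F) :
    (leftField (v + w) : Π k : K, TangentSpace 𝓘(ℝ, F) k) = leftField v + leftField w :=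
  funext fun k => (leftTrans F k).map_add v w

lemma leftField_smul (c : ℝ) (v : F) :
    (leftField (c • v) : Π k : K, TangentSpace 𝓘(ℝ, F) k) = c • leftField v :=
  funext fun k => (leftTrans F k).map_smul c v

lemma leftCoord_rightField_one (v : GroupLieAlgebra 𝓘(ℝ, F) K) :
    leftCoord (rightField v) (1 : K) = (v : F) := by
  have h : (rightField v (1 : K) : F) = v :=
    congrArg (fun L : F →L[ℝ] F => L v) rightTrans_one
  rw [leftCoord, leftForm_one]
  exact h

variable [LieGroup 𝓘(ℝ, F) ∞ K]

variable (F) in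
lemma mdifferentiable_mul_left' (a : K) :
    MDifferentiable 𝓘(ℝ, F) 𝓘(ℝ, F) (fun x : K => a * x) :=
  (contMDiff_mul_left (I := 𝓘(ℝ, F)) (n := ∞)).mdifferentiable (by simp)

variable (F) in
lemma mdifferentiable_mul_right' (a : K) :
    MDifferentiable 𝓘(ℝ, F) 𝓘(ℝ, F) (fun x : K => x * a) :=
  (contMDiff_mul_right (I := 𝓘(ℝ, F)) (n := ∞)).mdifferentiable (by simp)

lemma tmap_mul_left_leftTrans (a b : K) (v : F) :
    tmap F F (fun x : K => a * x) b (leftTrans F b v) = leftTrans F (a * b) v := by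
  have h := tmap_comp_apply (E := F) (E' := F) (E'' := F) (g := fun x : K => a * x)
    (f := fun x : K => b * x) (x := 1) (mul_one b) (mdifferentiable_mul_left' F a b)
    (mdifferentiable_mul_left' F b 1) v
  rw [leftTrans, ← h, leftTrans]
  simp only [mul_assoc]

/-- Left invariance of the Maurer-Cartan form, from (ab)⁻¹(ax) = b⁻¹x. -/
lemma leftForm_tmap_mul_left (a b : K) (v : F) :
    leftForm F (a * b) (tmap F F (fun x : K => a * x) b v) = leftForm F b v := by
  have h := tmap_comp_apply (E := F) (E' := F) (E'' := F) (g := fun x : K => (a * b)⁻¹ * x)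
    (f := fun x : K => a * x) (x := b) rfl (mdifferentiable_mul_left' F _ _)
    (mdifferentiable_mul_left' F _ _) v
  rw [leftForm, ← h, leftForm]
  simp only [mul_inv_rev, mul_assoc, inv_mul_cancel_left]

lemma leftForm_leftTrans (k : K) (v : F) : leftForm F k (leftTrans F k v) = v := by
  have h := leftForm_tmap_mul_left k 1 v
  rw [mul_one, leftForm_one] at h
  exact h

lemma leftTrans_leftForm (k : K) (v : F) : leftTrans F k (leftForm F k v) = v := by
  have h := tmap_comp_apply (E := F) (E' := F) (E'' := F) (g := fun x : K => k * x)
    (f := fun x : K => k⁻¹ * x) (x := k) (inv_mul_cancel k) (mdifferentiable_mul_left' F _ _)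
    (mdifferentiable_mul_left' F _ _) v
  simp only [mul_inv_cancel_left, tmap_id] at h
  exact h.symm

lemma leftCoord_leftField (v : F) : leftCoord (leftField v : Π _ : K, _) = fun _ => v :=
  funext fun k => leftForm_leftTrans k v

/-- On the diagonal the map (k, x) ↦ k⁻¹x is constantly 1, so no coordinate change is needed in the
target. -/
lemma contMDiffAt_leftForm (k₀ : K) :
    ContMDiffAt 𝓘(ℝ, F) 𝓘(ℝ, F →L[ℝ] F) ∞ (fun k => leftForm F k ∘L ofCoord F k₀ k) k₀ := by
  have h := contMDiffAt_tmap (E := F) (E' := F) (E'' := F) (f := fun k x : K => k⁻¹ * x) (g := id)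
    (x₀ := k₀) ((contMDiff_inv 𝓘(ℝ, F) ∞).comp contMDiff_fst |>.mul contMDiff_snd).contMDiffAt
    contMDiffAt_id
  simp only [id, inv_mul_cancel, toCoord_self, ContinuousLinearMap.id_comp] at h
  exact h

lemma contMDiffAt_leftTrans (k₀ : K) :
    ContMDiffAt 𝓘(ℝ, F) 𝓘(ℝ, F →L[ℝ] F) ∞ (fun k => toCoord F k₀ k ∘L leftTrans F k) k₀ := by
  have h := contMDiffAt_tmap (E := F) (E' := F) (E'' := F) (f := fun k x : K => k * x)
    (g := fun _ => 1) (x₀ := k₀) (contMDiff_mul 𝓘(ℝ, F) ∞).contMDiffAt contMDiffAt_const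
  simp only [mul_one, ofCoord_self, ContinuousLinearMap.comp_id] at h
  exact h

lemma contMDiffAt_rightTrans (k₀ : K) :
    ContMDiffAt 𝓘(ℝ, F) 𝓘(ℝ, F →L[ℝ] F) ∞ (fun k => toCoord F k₀ k ∘L rightTrans F k) k₀ := by
  have h := contMDiffAt_tmap (E := F) (E' := F) (E'' := F) (f := fun k x : K => x * k)
    (g := fun _ => 1) (x₀ := k₀) (contMDiff_snd.mul contMDiff_fst).contMDiffAt contMDiffAt_const
  simp only [one_mul, ofCoord_self, ContinuousLinearMap.comp_id] at h
  exact h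

lemma smoothField_leftField (v : F) : SmoothField 𝓘(ℝ, F) (leftField v : Π _ : K, _) :=
  fun k₀ => contMDiffAt_section_iff.2 ((contMDiffAt_leftTrans k₀).clm_apply contMDiffAt_const)

lemma smoothField_rightField (v : GroupLieAlgebra 𝓘(ℝ, F) K) :
    SmoothField 𝓘(ℝ, F) (rightField v : Π _ : K, _) :=
  fun k₀ => contMDiffAt_section_iff.2
    ((contMDiffAt_rightTrans k₀).clm_apply (contMDiffAt_const (I' := 𝓘(ℝ, F)) (M' := F) (c := v)))

lemma leftCoord_eventuallyEq (Y : Π k : K, TangentSpace 𝓘(ℝ, F) k) (k₀ : K) :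
    leftCoord Y =ᶠ[𝓝 k₀] fun k => (leftForm F k ∘L ofCoord F k₀ k) (toCoord F k₀ k (Y k)) := by
  filter_upwards [(chartAt F k₀).open_source.mem_nhds (mem_chart_source F k₀)] with k hk
  exact congrArg (leftForm F k) (ofCoord_toCoord hk _).symm

lemma contMDiffAt_leftCoord {Y : Π k : K, TangentSpace 𝓘(ℝ, F) k} {k₀ : K}
    (hY : ContMDiffAt 𝓘(ℝ, F) 𝓘(ℝ, F).tangent ∞
      (fun x => (⟨x, Y x⟩ : TangentBundle 𝓘(ℝ, F) K)) k₀) :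
    ContMDiffAt 𝓘(ℝ, F) 𝓘(ℝ, F) ∞ (leftCoord Y) k₀ :=
  ((contMDiffAt_leftForm k₀).clm_apply (contMDiffAt_section_iff.1 hY)).congr_of_eventuallyEq
    (leftCoord_eventuallyEq Y k₀)

lemma mdifferentiableAt_leftCoord {Y : Π k : K, TangentSpace 𝓘(ℝ, F) k} {k₀ : K}
    (hY : MDifferentiableAt 𝓘(ℝ, F) 𝓘(ℝ, F).tangent
      (fun x => (⟨x, Y x⟩ : TangentBundle 𝓘(ℝ, F) K)) k₀) :
    MDifferentiableAt 𝓘(ℝ, F) 𝓘(ℝ, F) (leftCoord Y) k₀ :=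
  (((contMDiffAt_leftForm k₀).mdifferentiableAt (by simp)).clm_apply
    (mdifferentiableAt_section_iff.1 hY)).congr_of_eventuallyEq (leftCoord_eventuallyEq Y k₀)

/-- The left invariant connection with `D_{X^L} Y^L = C(X, Y)^L` for the left invariant
vector fields of `X` and `Y`. -/
noncomputable def leftConn (C : F →L[ℝ] F →L[ℝ] F) : Connection 𝓘(ℝ, F) K where
  toFun Y k := (leftTrans F k ∘L (tmap F F (leftCoord Y) k
    + C.flip (leftCoord Y k) ∘L leftForm F k) : F →L[ℝ] F)
  isCovariantDerivativeOnUniv :=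
    { add := by
        intro Y Z k hY hZ _
        have h : leftCoord (Y + Z) = fun x => leftCoord Y x + leftCoord Z x :=
          funext fun x => (leftForm F x).map_add _ _
        refine ContinuousLinearMap.ext fun v => ?_
        change leftTrans F k (tmap F F (leftCoord (Y + Z)) k v
          + C (leftForm F k v) (leftCoord (Y + Z) k))
          = leftTrans F k (tmap F F (leftCoord Y) k v + C (leftForm F k v) (leftCoord Y k))
          + leftTrans F k (tmap F F (leftCoord Z) k v + C (leftForm F k v) (leftCoord Z k))
        rw [h, tmap_add (mdifferentiableAt_leftCoord hY) (mdifferentiableAt_leftCoord hZ)]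
        simp only [add_apply, map_add]
        abel
      leibniz := by
        intro Y g k hY hg _
        have h : leftCoord (g • Y) = fun x => g x • leftCoord Y x :=
          funext fun x => (leftForm F x).map_smul _ _
        refine ContinuousLinearMap.ext fun v => ?_
        change leftTrans F k (tmap F F (leftCoord (g • Y)) k v
          + C (leftForm F k v) (leftCoord (g • Y) k))
          = g k • leftTrans F k (tmap F F (leftCoord Y) k v + C (leftForm F k v) (leftCoord Y k))
          + @HSMul.hSMul ℝ F F _ (tmap F ℝ g k v) (Y k)
        -- Writing `Y k` through its left component puts the Leibniz term under `leftTrans` with all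
        -- the others.
        have e : leftTrans F k (leftCoord Y k) = (Y k : F) := leftTrans_leftForm k _
        rw [h, tmap_smul hg (mdifferentiableAt_leftCoord hY), ← e]
        simp only [add_apply, map_add, smul_apply,
          ContinuousLinearMap.smulRight_apply, map_smul, smul_add]
        abel }

lemma leftConn_nabla (C : F →L[ℝ] F →L[ℝ] F) (X Y : Π k : K, TangentSpace 𝓘(ℝ, F) k) (k : K) :
    (leftConn C).nabla X Y k =
      leftTrans F k (tmap F F (leftCoord Y) k (X k) + C (leftCoord X k) (leftCoord Y k)) := rfl

lemma leftConn_isSmooth (C : F →L[ℝ] F →L[ℝ] F) :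
    (leftConn C : Connection 𝓘(ℝ, F) K).IsSmooth := by
  refine ⟨⟨fun {Y} hY k₀ _ => ContMDiffAt.contMDiffWithinAt ?_⟩⟩
  have hY' : ContMDiffAt 𝓘(ℝ, F) 𝓘(ℝ, F) ∞ (leftCoord Y) k₀ :=
    contMDiffAt_leftCoord ((contMDiffOn_univ.1 hY).contMDiffAt)
  rw [contMDiffAt_homSection_iff]
  have hd : ContMDiffAt 𝓘(ℝ, F) 𝓘(ℝ, F →L[ℝ] F) ∞
      (fun k => tmap F F (leftCoord Y) k ∘L ofCoord F k₀ k) k₀ := by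
    have h := contMDiffAt_tmap (E := F) (E' := F) (E'' := F) (f := fun _ : K => leftCoord Y)
      (g := id) (x₀ := k₀) (hY'.comp (k₀, k₀) contMDiffAt_snd) contMDiffAt_id
    -- `leftCoord Y` takes values in a vector space, where coordinate changes are trivial.
    simpa only [id, toCoord_model, ContinuousLinearMap.id_comp] using h
  have hC : ContMDiffAt 𝓘(ℝ, F) 𝓘(ℝ, F →L[ℝ] F) ∞ (fun k => C.flip (leftCoord Y k)) k₀ :=
    C.flip.contDiff.contMDiff.contMDiffAt.comp k₀ hY'
  refine ((contMDiffAt_leftTrans k₀).clm_comp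
    (hd.add (hC.clm_comp (contMDiffAt_leftForm k₀)))).congr_of_eventuallyEq
      (Filter.Eventually.of_forall fun k => ?_)
  ext v
  rfl

end LieGroup

/-! ### Tensoriality of the difference of two connections. -/

section Comparison

variable {F : Type*} [NormedAddCommGroup F] [NormedSpace ℝ F] [FiniteDimensional ℝ F]
  {M : Type*} [TopologicalSpace M] [ChartedSpace F M] [IsManifold 𝓘(ℝ, F) ∞ M]

/-- Two connections agree on `Y` at `x` as soon as they agree on some field with the same value
at `x`. -/
lemma Connection.apply_eq_of_apply_eq {D D' : Connection 𝓘(ℝ, F) M}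
    {Y Z : Π x : M, TangentSpace 𝓘(ℝ, F) x} (hY : SmoothField 𝓘(ℝ, F) Y)
    (hZ : SmoothField 𝓘(ℝ, F) Z) {x : M} (hYZ : Y x = Z x) (h : D Z x = D' Z x) :
    D Y x = D' Y x := by
  have h1 := IsCovariantDerivativeOn.difference_apply D.isCovariantDerivativeOnUniv
    D'.isCovariantDerivativeOnUniv (x := x) trivial ((hY x).mdifferentiableAt (by simp))
  have h2 := IsCovariantDerivativeOn.difference_apply D.isCovariantDerivativeOnUniv
    D'.isCovariantDerivativeOnUniv (x := x) trivial ((hZ x).mdifferentiableAt (by simp))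
  rw [hYZ, h2] at h1
  exact sub_eq_zero.1 (h1.symm.trans (sub_eq_zero.2 h))

end Comparison

/-! ### Left invariant connections, and maps compatible with Maurer-Cartan forms. -/

section LeftInvariant

variable {E : Type*} [NormedAddCommGroup E] [NormedSpace ℝ E]
  {G : Type*} [TopologicalSpace G] [ChartedSpace E G] [Group G]
  {F : Type*} [NormedAddCommGroup F] [NormedSpace ℝ F]
  {K : Type*} [TopologicalSpace K] [ChartedSpace F K] [Group K]

/-- The hypothesis `hp` holds for left translations with `p` the identity and for homomorphisms with
`p` the differential at 1, so the same computation serves both. -/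
lemma leftCoord_of_related {f : G → K} {p : E →L[ℝ] F}
    (hp : ∀ g v, leftForm F (f g) (tmap E F f g v) = p (leftForm E g v))
    {X : Π g : G, TangentSpace 𝓘(ℝ, E) g} {X' : Π k : K, TangentSpace 𝓘(ℝ, F) k}
    (hX : Related 𝓘(ℝ, E) 𝓘(ℝ, F) f X X') (g : G) :
    leftCoord X' (f g) = p (leftCoord X g) := by
  have h : (tmap E F f g (X g) : F) = X' (f g) := hX g
  exact (congrArg (leftForm F (f g)) h).symm.trans (hp g _)

variable [LieGroup 𝓘(ℝ, E) ∞ G] [LieGroup 𝓘(ℝ, F) ∞ K]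

lemma tmap_leftTrans_of_leftForm {f : G → K} {p : E →L[ℝ] F}
    (hp : ∀ g v, leftForm F (f g) (tmap E F f g v) = p (leftForm E g v)) (g : G) (v : E) :
    tmap E F f g (leftTrans E g v) = leftTrans F (f g) (p v) := by
  rw [← leftTrans_leftForm (f g) (tmap E F f g _), hp, leftForm_leftTrans]

lemma tmap_leftCoord_of_related {f : G → K} {p : E →L[ℝ] F}
    (hf : ContMDiff 𝓘(ℝ, E) 𝓘(ℝ, F) ∞ f)
    (hp : ∀ g v, leftForm F (f g) (tmap E F f g v) = p (leftForm E g v))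
    {Y : Π g : G, TangentSpace 𝓘(ℝ, E) g} {Y' : Π k : K, TangentSpace 𝓘(ℝ, F) k}
    (hYs : SmoothField 𝓘(ℝ, E) Y) (hYs' : SmoothField 𝓘(ℝ, F) Y')
    (hY : Related 𝓘(ℝ, E) 𝓘(ℝ, F) f Y Y') (g : G) (v : E) :
    tmap F F (leftCoord Y') (f g) (tmap E F f g v) = p (tmap E E (leftCoord Y) g v) := by
  have h1 := (contMDiffAt_leftCoord (hYs' (f g))).mdifferentiableAt (by simp)
  have h2 := (contMDiffAt_leftCoord (hYs g)).mdifferentiableAt (by simp)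
  rw [← tmap_comp_apply (E := E) (E' := F) (E'' := F) rfl h1 (hf.mdifferentiable (by simp) g) v,
    funext fun g => leftCoord_of_related hp hY g, tmap_clm_comp p h2]
  rfl

/-- The derivative term is carried over by the chain rule, so only the algebraic terms must be
compared. The hypothesis `hC` is needed only for the components at `g`; in the reductive case it is
available only at suitable points. -/
lemma leftConn_nabla_of_related {f : G → K} {p : E →L[ℝ] F}
    (hf : ContMDiff 𝓘(ℝ, E) 𝓘(ℝ, F) ∞ f)
    (hp : ∀ g v, leftForm F (f g) (tmap E F f g v) = p (leftForm E g v))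
    {C : E →L[ℝ] E →L[ℝ] E} {C' : F →L[ℝ] F →L[ℝ] F}
    {X Y : Π g : G, TangentSpace 𝓘(ℝ, E) g} {X' Y' : Π k : K, TangentSpace 𝓘(ℝ, F) k}
    (hYs : SmoothField 𝓘(ℝ, E) Y) (hYs' : SmoothField 𝓘(ℝ, F) Y')
    (hX : Related 𝓘(ℝ, E) 𝓘(ℝ, F) f X X') (hY : Related 𝓘(ℝ, E) 𝓘(ℝ, F) f Y Y') (g : G)
    (hC : C' (p (leftCoord X g)) (p (leftCoord Y g)) = p (C (leftCoord X g) (leftCoord Y g))) :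
    tmap E F f g ((leftConn C).nabla X Y g) = (leftConn C').nabla X' Y' (f g) := by
  have h : (tmap E F f g (X g) : F) = X' (f g) := hX g
  rw [leftConn_nabla, leftConn_nabla, tmap_leftTrans_of_leftForm hp, map_add,
    leftCoord_of_related hp hX, leftCoord_of_related hp hY, hC]
  refine congrArg (fun w => leftTrans F (f g) (w + p (C (leftCoord X g) (leftCoord Y g)))) ?_
  exact (tmap_leftCoord_of_related hf hp hYs hYs' hY g _).symm.trans
    (congrArg (tmap F F (leftCoord Y') (f g)) h)

lemma leftConn_isLeftInvariant (C : F →L[ℝ] F →L[ℝ] F) :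
    (leftConn C : Connection 𝓘(ℝ, F) K).IsLeftInvariant := fun k =>
  ⟨contMDiff_mul_left, fun _ _ _ _ _ hY _ hY' hXX' hYY' x =>
    leftConn_nabla_of_related contMDiff_mul_left (p := ContinuousLinearMap.id ℝ F)
      (leftForm_tmap_mul_left k) hY hY' hXX' hYY' x rfl⟩

lemma related_leftField (k : K) (v : F) :
    Related 𝓘(ℝ, F) 𝓘(ℝ, F) (fun x : K => k * x) (leftField v) (leftField v) :=
  fun x => tmap_mul_left_leftTrans k x v

/-- Right translation by k followed by left translation by k⁻¹ is conjugation by k⁻¹. -/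
lemma leftCoord_rightField (v : GroupLieAlgebra 𝓘(ℝ, F) K) (k : K) :
    leftCoord (rightField v) k = (adjoint k⁻¹ v : F) := by
  have h := tmap_comp_apply (E := F) (E' := F) (E'' := F) (g := fun x : K => k⁻¹ * x)
    (f := fun x : K => x * k) (x := 1) (one_mul k) (mdifferentiable_mul_left' F _ _)
    (mdifferentiable_mul_right' F _ _) v
  refine h.symm.trans ?_
  have e : (fun x : K => k⁻¹ * (x * k)) = fun x => k⁻¹ * x * k⁻¹⁻¹ := by
    funext x
    rw [inv_inv, mul_assoc]
  rw [e]
  rfl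

lemma leftConn_nabla_rightField_one (C : F →L[ℝ] F →L[ℝ] F) (v w : GroupLieAlgebra 𝓘(ℝ, F) K) :
    ((leftConn C).nabla (rightField v) (rightField w) (1 : K) : F)
      = tmap F F (leftCoord (rightField w)) (1 : K) v + C v w := by
  have h : (rightField v (1 : K) : F) = v :=
    congrArg (fun L : F →L[ℝ] F => L v) rightTrans_one
  rw [leftConn_nabla, leftTrans_one, leftCoord_rightField_one, leftCoord_rightField_one]
  exact congrArg (fun u : F => tmap F F (leftCoord (rightField w)) (1 : K) u + C v w) h

lemma rightField_surjective (k : K) (w : F) :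
    ∃ v : GroupLieAlgebra 𝓘(ℝ, F) K, (rightField v k : F) = w := by
  refine ⟨tmap F F (fun x : K => x * k⁻¹) k w, ?_⟩
  have h := tmap_comp_apply (E := F) (E' := F) (E'' := F) (g := fun x : K => x * k)
    (f := fun x : K => x * k⁻¹) (x := k) (mul_inv_cancel k) (mdifferentiable_mul_right' F _ _)
    (mdifferentiable_mul_right' F _ _) w
  refine h.symm.trans ?_
  simp only [inv_mul_cancel_right, tmap_id]
  rfl

variable [FiniteDimensional ℝ F]

/-- The bilinear product on the tangent space at `1` given by the derivatives of left invariant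
vector fields. -/
noncomputable def leftProd (D : Connection 𝓘(ℝ, F) K) : F →L[ℝ] F →L[ℝ] F :=
  -- The covariant derivative takes the differentiated field first; the final `flip` puts the
  -- direction first.
  (LinearMap.toContinuousLinearMap (E := F) (F' := F →L[ℝ] F)
    { toFun := fun v : F => (D (leftField v) (1 : K) : F →L[ℝ] F)
      map_add' := fun v w => by
        rw [leftField_add]
        exact D.isCovariantDerivativeOnUniv.add
          ((smoothField_leftField v 1).mdifferentiableAt (by simp))
          ((smoothField_leftField w 1).mdifferentiableAt (by simp))
      map_smul' := fun c v => by
        rw [leftField_smul]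
        exact D.isCovariantDerivativeOnUniv.smul_const c
          ((smoothField_leftField v 1).mdifferentiableAt (by simp)) }).flip

lemma leftProd_apply (D : Connection 𝓘(ℝ, F) K) (v w : F) :
    leftProd D v w = D.nabla (leftField v) (leftField w) (1 : K) := by
  have h : (leftField v (1 : K) : F) = v := congrArg (fun L : F →L[ℝ] F => L v) leftTrans_one
  exact (congrArg (fun u : F => (D (leftField w) (1 : K) : F →L[ℝ] F) u) h).symm

/-- By tensoriality `Y` may be replaced at `k` by the left invariant field with the same value. Its
components are constant, so only the algebraic term survives, and left translation by `k` reduces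
the comparison to the identity. -/
lemma Connection.IsLeftInvariant.agree_leftConn {D : Connection 𝓘(ℝ, F) K}
    (hD : D.IsLeftInvariant) : D.Agree (leftConn (leftProd D)) := by
  intro X Y _ hY
  funext k
  have h0 : Y k = leftField (F := F) (K := K) (leftCoord Y k) k :=
    (leftTrans_leftForm (F := F) k (Y k)).symm
  refine congrArg (fun L : F →L[ℝ] F => L (X k))
    (Connection.apply_eq_of_apply_eq hY (smoothField_leftField (F := F) (leftCoord Y k)) h0 ?_)
  refine ContinuousLinearMap.ext fun (v : F) => ?_
  let w : F := leftCoord Y k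
  let u : F := leftForm F k v
  have hv : (leftField u k : F) = v := leftTrans_leftForm k v
  have h1 : leftTrans F k (leftProd D u w) = D.nabla (leftField u) (leftField w) k := by
    have h := (hD k).2 _ _ _ _ (smoothField_leftField u) (smoothField_leftField w)
      (smoothField_leftField u) (smoothField_leftField w) (related_leftField k u)
      (related_leftField k w) 1
    have e : ∀ k' : K, k' = k → (D.nabla (leftField u) (leftField w) k' : F)
      = D.nabla (leftField u) (leftField w) k := by rintro _ rfl; rfl
    rw [leftProd_apply]
    exact h.trans (e _ (mul_one k))
  have h2 : (leftConn (leftProd D)).nabla (leftField u) (leftField w) k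
      = leftTrans F k (leftProd D u w) := by
    rw [leftConn_nabla, leftCoord_leftField, leftCoord_leftField, tmap_const]
    exact congrArg (leftTrans F k) (zero_add _)
  have h3 : (D (leftField w) k : F →L[ℝ] F) (leftField u k)
    = (leftConn (leftProd D) (leftField w) k : F →L[ℝ] F) (leftField u k) := h1.symm.trans h2.symm
  rw [hv] at h3
  exact h3

end LeftInvariant

/-! ### Local sections of submersions and curves in their fibers. -/

section Submersion

variable {E : Type*} [NormedAddCommGroup E] [NormedSpace ℝ E]
  {E' : Type*} [NormedAddCommGroup E'] [NormedSpace ℝ E']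
  {M : Type*} [TopologicalSpace M] [ChartedSpace E M]
  {M' : Type*} [TopologicalSpace M'] [ChartedSpace E' M']
  {f : M → M'} {x : M}

lemma codChart_comp_symm (h : IsSubmersionAt 𝓘(ℝ, E) 𝓘(ℝ, E') ∞ f x) {u : E}
    (hu : u ∈ h.domChart.target) : h.codChart (f (h.domChart.symm u)) = (h.equiv u).1 :=
  h.writtenInCharts (show u ∈ (h.domChart.extend 𝓘(ℝ, E)).target by
    simpa using hu)

lemma codChart_comp (h : IsSubmersionAt 𝓘(ℝ, E) 𝓘(ℝ, E') ∞ f x) {y : M}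
    (hy : y ∈ h.domChart.source) : h.codChart (f y) = (h.equiv (h.domChart y)).1 := by
  have := codChart_comp_symm h (h.domChart.map_source hy)
  rwa [h.domChart.left_inv hy] at this

/-- A submersion has smooth local sections. -/
lemma exists_localSection (h : IsSubmersionAt 𝓘(ℝ, E) 𝓘(ℝ, E') ∞ f x) :
    ∃ s : M' → M, ContMDiffAt 𝓘(ℝ, E') 𝓘(ℝ, E) ∞ s (f x) ∧ s (f x) = x ∧
      ∀ᶠ y in 𝓝 (f x), f (s y) = y := by
  have hx := h.mem_domChart_source
  have hfx := h.mem_codChart_source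
  -- The section freezes the fiber coordinate at its value at `x`, which makes it pass through `x`.
  let c := (h.equiv (h.domChart x)).2
  have hc : h.equiv.symm (h.codChart (f x), c) = h.domChart x := by
    rw [codChart_comp h hx]
    exact h.equiv.symm_apply_apply _
  have hψ : ContMDiffAt 𝓘(ℝ, E') 𝓘(ℝ, E') ∞ h.codChart (f x) :=
    contMDiffAt_of_mem_maximalAtlas h.codChart_mem_maximalAtlas hfx
  have hl : ContDiff ℝ ∞ (fun u : E' => h.equiv.symm (u, c)) :=
    h.equiv.symm.contDiff.comp (contDiff_id.prodMk contDiff_const)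
  have hu : ContMDiffAt 𝓘(ℝ, E') 𝓘(ℝ, E) ∞
      (fun y => h.equiv.symm (h.codChart y, c)) (f x) := hl.contMDiff.contMDiffAt.comp (f x) hψ
  have ht : h.equiv.symm (h.codChart (f x), c) ∈ h.domChart.target :=
    hc ▸ h.domChart.map_source hx
  have hφ : ContMDiffAt 𝓘(ℝ, E) 𝓘(ℝ, E) ∞ h.domChart.symm
      (h.equiv.symm (h.codChart (f x), c)) :=
    contMDiffAt_symm_of_mem_maximalAtlas h.domChart_mem_maximalAtlas ht
  refine ⟨fun y => h.domChart.symm (h.equiv.symm (h.codChart y, c)), hφ.comp (f x) hu, ?_, ?_⟩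
  · simp only [hc, h.domChart.left_inv hx]
  · filter_upwards [h.codChart.open_source.mem_nhds hfx,
      hu.continuousAt.preimage_mem_nhds (h.domChart.open_target.mem_nhds ht)] with y hy hy'
    refine h.codChart.injOn (h.source_subset_preimage_source (h.domChart.map_target hy')) hy ?_
    rw [codChart_comp_symm h hy', h.equiv.apply_symm_apply]

/-- A map out of the target of a submersion is smooth if its composition with the submersion is. -/
lemma contMDiffAt_of_comp_submersion {E'' : Type*} [NormedAddCommGroup E''] [NormedSpace ℝ E'']
    {N : Type*} [TopologicalSpace N] [ChartedSpace E'' N]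
    (h : IsSubmersionAt 𝓘(ℝ, E) 𝓘(ℝ, E') ∞ f x) {q : M' → N}
    (hq : ContMDiffAt 𝓘(ℝ, E) 𝓘(ℝ, E'') ∞ (fun y => q (f y)) x) :
    ContMDiffAt 𝓘(ℝ, E') 𝓘(ℝ, E'') ∞ q (f x) := by
  obtain ⟨s, hs, hsx, hfs⟩ := exists_localSection h
  refine (ContMDiffAt.comp_of_eq hq hs hsx).congr_of_eventuallyEq ?_
  filter_upwards [hfs] with y hy
  exact (congrArg q hy).symm

/-- The derivative of a local section through `x` is a right inverse. -/
lemma tmap_surjective_of_submersion (h : IsSubmersionAt 𝓘(ℝ, E) 𝓘(ℝ, E') ∞ f x) :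
    Function.Surjective (tmap E E' f x) := by
  obtain ⟨s, hs, hsx, hfs⟩ := exists_localSection h
  intro w
  refine ⟨tmap E' E s (f x) w, ?_⟩
  rw [← tmap_comp_apply hsx (h.contMDiffAt.mdifferentiableAt (by simp))
    (hs.mdifferentiableAt (by simp)), tmap_congr hfs, tmap_id]
  rfl

/-- A vector in the kernel of the derivative of a submersion is tangent to a curve in the fiber. -/
lemma exists_curve_of_tmap_eq_zero (h : IsSubmersionAt 𝓘(ℝ, E) 𝓘(ℝ, E') ∞ f x) {v : E}
    (hv : tmap E E' f x v = 0) :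
    ∃ γ : ℝ → M, ContMDiff 𝓘(ℝ, ℝ) 𝓘(ℝ, E) ∞ γ ∧ (∀ t, f (γ t) = f x) ∧ γ 0 = x ∧
      tmap ℝ E γ 0 1 = v := by
  have hx := h.mem_domChart_source
  have hfx := h.mem_codChart_source
  have hφ : MDifferentiableAt 𝓘(ℝ, E) 𝓘(ℝ, E) h.domChart x :=
    (contMDiffAt_of_mem_maximalAtlas h.domChart_mem_maximalAtlas hx).mdifferentiableAt (by simp)
  have hψ : MDifferentiableAt 𝓘(ℝ, E') 𝓘(ℝ, E') h.codChart (f x) :=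
    (contMDiffAt_of_mem_maximalAtlas h.codChart_mem_maximalAtlas hfx).mdifferentiableAt (by simp)
  have hφs : ∀ u ∈ h.domChart.target, ContMDiffAt 𝓘(ℝ, E) 𝓘(ℝ, E) ∞ h.domChart.symm u :=
    fun u hu => contMDiffAt_symm_of_mem_maximalAtlas h.domChart_mem_maximalAtlas hu
  have ht := h.domChart.map_source hx
  set w : E := tmap E E h.domChart x v with hw
  -- In adapted charts the map is the projection to the first factor, so a kernel vector has only a
  -- fiber component.
  have hw1 : (h.equiv w).1 = 0 := by
    let L : E →L[ℝ] E' := ContinuousLinearMap.fst ℝ E' h.complement ∘L (h.equiv : E →L[ℝ] E' × h.complement)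
    have e : (fun y => h.codChart (f y)) =ᶠ[𝓝 x] fun y => L (h.domChart y) := by
      filter_upwards [h.domChart.open_source.mem_nhds hx] with y hy
      exact codChart_comp h hy
    have e2 := congrArg (fun T : E →L[ℝ] E' => T v)
      (tmap_congr (E := E) (E' := E') e)
    rw [tmap_comp_apply rfl hψ (h.contMDiffAt.mdifferentiableAt (by simp)), hv, map_zero,
      tmap_clm_comp L hφ] at e2
    exact e2.symm
  obtain ⟨r, hr, hball⟩ := Metric.isOpen_iff.1 h.domChart.open_target _ ht
  obtain ⟨ε, hε, hεr⟩ : ∃ ε : ℝ, 0 < ε ∧ ε * ‖w‖ < r :=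
    ⟨r / (‖w‖ + 1), by positivity, by
      rw [div_mul_eq_mul_div, div_lt_iff₀ (by positivity)]
      nlinarith [norm_nonneg w]⟩
  -- The sine bends the line into a curve defined for all times that stays in the ball of radius
  -- `r`, as ε‖w‖ < r. The scaling by ε inside and outside keeps the velocity at 0 equal to `w`.
  let c : ℝ → E := fun t => h.domChart x + (ε * Real.sin (t / ε)) • w
  have hc : ContDiff ℝ ∞ c := contDiff_const.add
    ((contDiff_const.mul (Real.contDiff_sin.comp (contDiff_id.div_const ε))).smul contDiff_const)
  have hct : ∀ t, c t ∈ h.domChart.target := fun t => hball (by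
    rw [Metric.mem_ball, dist_eq_norm, add_sub_cancel_left, norm_smul, Real.norm_eq_abs, abs_mul,
      abs_of_pos hε]
    refine lt_of_le_of_lt (mul_le_mul_of_nonneg_right
      (mul_le_of_le_one_right hε.le (Real.abs_sin_le_one _)) (norm_nonneg w)) hεr)
  have hc0 : c 0 = h.domChart x := by simp [c]
  have hdc : HasDerivAt c w 0 := by
    have h1 : HasDerivAt (fun t : ℝ => ε * Real.sin (t / ε)) 1 0 := by
      have := ((Real.hasDerivAt_sin ((0 : ℝ) / ε)).comp 0
        ((hasDerivAt_id (0 : ℝ)).div_const ε)).const_mul ε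
      simpa [hε.ne'] using this
    have := (h1.smul_const w).const_add (h.domChart x)
    rwa [one_smul] at this
  refine ⟨fun t => h.domChart.symm (c t), fun t => (hφs _ (hct t)).comp t hc.contMDiff.contMDiffAt,
    fun t => ?_, by simp only [hc0, h.domChart.left_inv hx], ?_⟩
  · refine h.codChart.injOn (h.source_subset_preimage_source (h.domChart.map_target (hct t))) hfx ?_
    rw [codChart_comp_symm h (hct t), codChart_comp h hx]
    simp [c, hw1]
  · have hs := (hφs _ ht).mdifferentiableAt (n := ∞) (by simp)
    rw [tmap_comp_apply hc0 hs (hc.contMDiff.mdifferentiable (by simp) 0), tmap_eq_fderiv,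
      show fderiv ℝ c 0 1 = w from hdc.deriv ▸ fderiv_apply_one_eq_deriv, hw,
      ← tmap_comp_apply rfl hs hφ]
    have e : (fun y => h.domChart.symm (h.domChart y)) =ᶠ[𝓝 x] fun y => y := by
      filter_upwards [h.domChart.open_source.mem_nhds hx] with y hy
      exact h.domChart.left_inv hy
    rw [tmap_congr e, tmap_id]
    rfl

end Submersion

/-! ### The Lie bracket in charts and as a commutator of derivations. -/

section Bracket

variable {E : Type*} [NormedAddCommGroup E] [NormedSpace ℝ E]
  {E' : Type*} [NormedAddCommGroup E'] [NormedSpace ℝ E']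
  {M : Type*} [TopologicalSpace M] [ChartedSpace E M] [IsManifold 𝓘(ℝ, E) ∞ M]

lemma mdifferentiableAt_chart {x y : M} (hy : y ∈ (chartAt E x).source) :
    MDifferentiableAt 𝓘(ℝ, E) 𝓘(ℝ, E) (chartAt E x) y :=
  (contMDiffAt_of_mem_maximalAtlas (n := ∞) (IsManifold.chart_mem_maximalAtlas x)
    hy).mdifferentiableAt (by simp)

lemma contMDiffAt_chart_symm {x : M} {u : E} (hu : u ∈ (chartAt E x).target) :
    ContMDiffAt 𝓘(ℝ, E) 𝓘(ℝ, E) ∞ (chartAt E x).symm u :=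
  contMDiffAt_symm_of_mem_maximalAtlas (IsManifold.chart_mem_maximalAtlas x) hu

lemma mdifferentiableAt_chart_symm {x : M} {u : E} (hu : u ∈ (chartAt E x).target) :
    MDifferentiableAt 𝓘(ℝ, E) 𝓘(ℝ, E) (chartAt E x).symm u :=
  (contMDiffAt_chart_symm hu).mdifferentiableAt (by simp)

lemma tmap_chart_symm_tmap_chart {x y : M} (hy : y ∈ (chartAt E x).source) (v : E) :
    tmap E E (chartAt E x).symm (chartAt E x y) (tmap E E (chartAt E x) y v) = v := by
  rw [← tmap_comp_apply rfl (mdifferentiableAt_chart_symm ((chartAt E x).map_source hy))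
    (mdifferentiableAt_chart hy)]
  have e : (fun z => (chartAt E x).symm (chartAt E x z)) =ᶠ[𝓝 y] fun z => z := by
    filter_upwards [(chartAt E x).open_source.mem_nhds hy] with z hz
    exact (chartAt E x).left_inv hz
  rw [tmap_congr e, tmap_id]
  rfl

lemma tmap_chart_tmap_chart_symm {x : M} {u : E} (hu : u ∈ (chartAt E x).target) (v : E) :
    tmap E E (chartAt E x) ((chartAt E x).symm u) (tmap E E (chartAt E x).symm u v) = v := by
  rw [← tmap_comp_apply rfl (mdifferentiableAt_chart ((chartAt E x).map_target hu))
    (mdifferentiableAt_chart_symm hu)]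
  have e : (fun z => chartAt E x ((chartAt E x).symm z)) =ᶠ[𝓝 u] fun z => z := by
    filter_upwards [(chartAt E x).open_target.mem_nhds hu] with z hz
    exact (chartAt E x).right_inv hz
  rw [tmap_congr e, tmap_id]
  rfl

/-- The components of a vector field in the chart at `x`. -/
noncomputable def chartField (x : M) (V : Π y : M, TangentSpace 𝓘(ℝ, E) y) (u : E) : E :=
  tmap E E (chartAt E x) ((chartAt E x).symm u) (V ((chartAt E x).symm u))

lemma mpullbackWithin_chart_symm {x : M} (V : Π y : M, TangentSpace 𝓘(ℝ, E) y) {u : E}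
    (hu : u ∈ (chartAt E x).target) :
    (VectorField.mpullbackWithin 𝓘(ℝ, E) 𝓘(ℝ, E) (extChartAt 𝓘(ℝ, E) x).symm V
      (Set.range 𝓘(ℝ, E)) u : E) = chartField x V u := by
  have h : ((mfderivWithin 𝓘(ℝ, E) 𝓘(ℝ, E) (extChartAt 𝓘(ℝ, E) x).symm
      (Set.range 𝓘(ℝ, E)) u : E →L[ℝ] E)) = tmap E E (chartAt E x).symm u := by
    rw [tmap, ← mfderivWithin_univ]
    simp only [mfld_simps]
    rfl
  have hi : (tmap E E (chartAt E x).symm u).inverse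
      = tmap E E (chartAt E x) ((chartAt E x).symm u) := by
    refine ContinuousLinearMap.inverse_eq (ContinuousLinearMap.ext fun v => ?_)
      (ContinuousLinearMap.ext fun v => tmap_chart_tmap_chart_symm hu v)
    have := tmap_chart_symm_tmap_chart ((chartAt E x).map_target hu) v
    rwa [(chartAt E x).right_inv hu] at this
  have e : (extChartAt 𝓘(ℝ, E) x).symm u = (chartAt E x).symm u := by simp only [mfld_simps]
  have h1 : (VectorField.mpullbackWithin 𝓘(ℝ, E) 𝓘(ℝ, E) (extChartAt 𝓘(ℝ, E) x).symm V
      (Set.range 𝓘(ℝ, E)) u : E) = ContinuousLinearMap.inverse (M := E) (M₂ := E)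
        (tmap E E (chartAt E x).symm u) (V ((chartAt E x).symm u)) :=
    congrArg (fun L : E →L[ℝ] E => L.inverse (V ((chartAt E x).symm u))) h
  rw [h1, hi]
  rfl

lemma tmap_chart_self (x : M) : tmap E E (chartAt E x) x = ContinuousLinearMap.id ℝ E := by
  rw [← toCoord_eq_tmap (mem_chart_source E x), toCoord_self]

/-- The chart at `x` has the identity as its derivative at `x`, so transporting the bracket back
from the model space changes nothing. -/
lemma mlieBracket_eq_lieBracket_chartField (V W : Π y : M, TangentSpace 𝓘(ℝ, E) y) (x : M) :
    (VectorField.mlieBracket 𝓘(ℝ, E) V W x : E)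
      = VectorField.lieBracket ℝ (chartField x V) (chartField x W) (chartAt E x x) := by
  have hx := (chartAt E x).map_source (mem_chart_source E x)
  let B : (Π y : M, TangentSpace 𝓘(ℝ, E) y) → E → E := fun V =>
    VectorField.mpullbackWithin 𝓘(ℝ, E) 𝓘(ℝ, E) (extChartAt 𝓘(ℝ, E) x).symm V
      (Set.range 𝓘(ℝ, E))
  have hev : ∀ V, B V =ᶠ[𝓝 (chartAt E x x)] chartField x V := fun V => by
    filter_upwards [(chartAt E x).open_target.mem_nhds hx] with u hu
    exact mpullbackWithin_chart_symm V hu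
  let L : E →L[ℝ] E := mfderiv 𝓘(ℝ, E) 𝓘(ℝ, E) (extChartAt 𝓘(ℝ, E) x) x
  have hL : L = ContinuousLinearMap.id ℝ E := by
    rw [← tmap_chart_self x, tmap]
    simp only [L, mfld_simps]
    rfl
  have h1 : L.inverse = ContinuousLinearMap.id ℝ E := hL ▸ ContinuousLinearMap.inverse_id
  have h2 : (VectorField.mlieBracket 𝓘(ℝ, E) V W x : E) =
      VectorField.lieBracketWithin ℝ (B V) (B W)
      ((extChartAt 𝓘(ℝ, E) x).symm ⁻¹' Set.univ ∩ Set.range 𝓘(ℝ, E)) (extChartAt 𝓘(ℝ, E) x x) :=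
    congrArg (fun L : E →L[ℝ] E => L _) h1
  have h3 : (extChartAt 𝓘(ℝ, E) x).symm ⁻¹' Set.univ ∩ Set.range 𝓘(ℝ, E) = Set.univ := by simp
  have h4 : extChartAt 𝓘(ℝ, E) x x = chartAt E x x := by simp only [mfld_simps]
  refine Eq.trans (α := E) h2 ?_
  rw [h3, VectorField.lieBracketWithin_univ, h4]
  exact Filter.EventuallyEq.lieBracket_vectorField_eq (𝕜 := ℝ) (hev V) (hev W)

lemma differentiableAt_chartField {V : Π y : M, TangentSpace 𝓘(ℝ, E) y}
    (hV : SmoothField 𝓘(ℝ, E) V) (x : M) :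
    DifferentiableAt ℝ (chartField x V) (chartAt E x x) := by
  have hx := (chartAt E x).map_source (mem_chart_source E x)
  have h1 := (contMDiffAt_section_iff.1 (hV x)).mdifferentiableAt (by simp)
  have h2 : MDifferentiableAt 𝓘(ℝ, E) 𝓘(ℝ, E)
      (fun u => toCoord E x ((chartAt E x).symm u) (V ((chartAt E x).symm u)))
      (chartAt E x x) := by
    have h3 := (chartAt E x).left_inv (mem_chart_source E x)
    exact MDifferentiableAt.comp (g := fun y : M => (toCoord E x y (V y) : E)) (chartAt E x x)
      (h3.symm ▸ h1) (mdifferentiableAt_chart_symm hx)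
  refine (mdifferentiableAt_iff_differentiableAt.1 h2).congr_of_eventuallyEq ?_
  filter_upwards [(chartAt E x).open_target.mem_nhds hx] with u hu
  rw [toCoord_eq_tmap ((chartAt E x).map_target hu)]
  rfl

/-- `df([V, W]) = V(df(W)) - W(df(V))` for a vector valued function `f`. -/
lemma tmap_mlieBracket {f : M → E'} {x : M} (hf : ContMDiffAt 𝓘(ℝ, E) 𝓘(ℝ, E') ∞ f x)
    {V W : Π y : M, TangentSpace 𝓘(ℝ, E) y} (hV : SmoothField 𝓘(ℝ, E) V)
    (hW : SmoothField 𝓘(ℝ, E) W) :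
    tmap E E' f x (VectorField.mlieBracket 𝓘(ℝ, E) V W x)
      = tmap E E' (fun y => tmap E E' f y (W y)) x (V x)
        - tmap E E' (fun y => tmap E E' f y (V y)) x (W x) := by
  have hxs := mem_chart_source E x
  have hx := (chartAt E x).map_source hxs
  have hxx := (chartAt E x).left_inv hxs
  let q : E → E' := fun u => f ((chartAt E x).symm u)
  have hq : ContDiffAt ℝ ∞ q (chartAt E x x) :=
    (ContMDiffAt.comp_of_eq hf (contMDiffAt_chart_symm hx) hxx).contDiffAt
  have hfev : ∀ᶠ y in 𝓝 x, MDifferentiableAt 𝓘(ℝ, E) 𝓘(ℝ, E') f y := by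
    have h1 : ContMDiffAt 𝓘(ℝ, E) 𝓘(ℝ, E') 1 f x := ContMDiffAt.of_le hf (by simp)
    filter_upwards [(contMDiffAt_iff_contMDiffAt_nhds (by simp)).1 h1] with y hy
    exact hy.mdifferentiableAt (by simp)
  have hev : ∀ V : Π y : M, TangentSpace 𝓘(ℝ, E) y, (fun y => tmap E E' f y (V y)) =ᶠ[𝓝 x]
      fun y => (fun u => fderiv ℝ q u (chartField x V u)) (chartAt E x y) := fun V => by
    filter_upwards [hfev, (chartAt E x).open_source.mem_nhds hxs] with y hy hys
    have hl := (chartAt E x).left_inv hys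
    have e := tmap_comp_apply (E := E) (E' := E) (E'' := E') (g := f) hl hy
      (mdifferentiableAt_chart_symm ((chartAt E x).map_source hys))
      (tmap E E (chartAt E x) y (V y))
    rw [tmap_eq_fderiv] at e
    have hVl : (V ((chartAt E x).symm (chartAt E x y)) : E) = V y :=
      congrArg (fun z => (V z : E)) hl
    rw [chartField, hVl, hl]
    exact (e.trans (congrArg (tmap E E' f y) (tmap_chart_symm_tmap_chart hys (V y)))).symm
  have hd : ∀ {V : Π y : M, TangentSpace 𝓘(ℝ, E) y}, SmoothField 𝓘(ℝ, E) V → ∀ v : E,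
      tmap E E' (fun y => tmap E E' f y (V y)) x v
        = fderiv ℝ (fderiv ℝ q) (chartAt E x x) v (chartField x V (chartAt E x x))
          + fderiv ℝ q (chartAt E x x) (fderiv ℝ (chartField x V) (chartAt E x x) v) := by
    intro V hV v
    have h1 : DifferentiableAt ℝ (fderiv ℝ q) (chartAt E x x) :=
      (hq.fderiv_right (m := 1) (by rw [one_add_one_eq_two]; exact ENat.LEInfty.out)).differentiableAt (by simp)
    have h2 := differentiableAt_chartField hV x
    rw [tmap_congr (hev V), tmap_comp_apply (E' := E)
      (g := fun u => fderiv ℝ q u (chartField x V u)) rfl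
      (h1.clm_apply h2).mdifferentiableAt (mdifferentiableAt_chart hxs), tmap_chart_self,
      tmap_eq_fderiv, fderiv_clm_apply h1 h2]
    simp [add_comm]
  have hc : ∀ V : Π y : M, TangentSpace 𝓘(ℝ, E) y, chartField x V (chartAt E x x) = (V x : E) := by
    intro V
    rw [chartField, hxx, tmap_chart_self]
    rfl
  -- The product rule leaves a second derivative of `q` in each iterated derivative; symmetry makes
  -- the two cancel in the difference.
  have hsymm := hq.isSymmSndFDerivAt (by simpa using ENat.LEInfty.out)
  have hfq : tmap E E' f x = fderiv ℝ q (chartAt E x x) := by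
    rw [← tmap_eq_fderiv]
    ext v
    rw [tmap_comp_apply (E' := E) hxx (hf.mdifferentiableAt (by simp))
      (mdifferentiableAt_chart_symm hx)]
    have := tmap_chart_symm_tmap_chart hxs v
    rw [tmap_chart_self] at this
    exact congrArg _ this.symm
  refine (congrArg (tmap E E' f x) (mlieBracket_eq_lieBracket_chartField V W x)).trans
    (Eq.trans ?_ (congrArg₂ (· - ·) (hd hW (V x)) (hd hV (W x))).symm)
  have hs : fderiv ℝ (fderiv ℝ q) (chartAt E x x) (V x : E) (W x : E)
    = fderiv ℝ (fderiv ℝ q) (chartAt E x x) (W x : E) (V x : E) := hsymm.eq _ _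
  rw [hfq, VectorField.lieBracket_eq]
  simp only [hc]
  refine (map_sub (fderiv ℝ q (chartAt E x x)) _ _).trans ?_
  refine Eq.trans ?_ (congrArg₂ (fun a b : E' => (a + _) - (b + _)) hs rfl).symm
  exact (add_sub_add_left_eq_sub _ _ _).symm

end Bracket

/-! ### The products on right and on left invariant fields. -/

section StarProduct

variable {E : Type*} [NormedAddCommGroup E] [NormedSpace ℝ E] [FiniteDimensional ℝ E]
  {G : Type*} [TopologicalSpace G] [ChartedSpace E G] [Group G] [LieGroup 𝓘(ℝ, E) ∞ G]

/-- The first summand does not depend on `D`, so each of the two products determines the other. -/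
lemma starProd_eq {D : Connection 𝓘(ℝ, E) G} (hD : D.IsLeftInvariant)
    (X Y : GroupLieAlgebra 𝓘(ℝ, E) G) :
    (starProd D X Y : E) = tmap E E (leftCoord (rightField Y)) (1 : G) X + leftProd D X Y := by
  rw [← leftConn_nabla_rightField_one, starProd,
    hD.agree_leftConn _ _ (smoothField_rightField X) (smoothField_rightField Y)]

end StarProduct

/-! ### Lie group homomorphisms and the kernel of their differential. -/

section Homomorphism

variable {E : Type*} [NormedAddCommGroup E] [NormedSpace ℝ E]
  {G : Type*} [TopologicalSpace G] [ChartedSpace E G] [Group G] [LieGroup 𝓘(ℝ, E) ∞ G]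
  {F : Type*} [NormedAddCommGroup F] [NormedSpace ℝ F]
  {K : Type*} [TopologicalSpace K] [ChartedSpace F K] [Group K] [LieGroup 𝓘(ℝ, F) ∞ K]
  {f : G →* K}

lemma leftForm_tmap_hom (hf : ContMDiff 𝓘(ℝ, E) 𝓘(ℝ, F) ∞ f)
    (g : G) (v : E) :
    leftForm F (f g) (tmap E F f g v) = tmap E F f 1 (leftForm E g v) := by
  have hd := hf.mdifferentiable (by simp)
  have h1 := tmap_comp_apply (E := E) (E' := F) (E'' := F) (g := fun x : K => (f g)⁻¹ * x)
    (f := f) (x := g) rfl (mdifferentiable_mul_left' F _ _) (hd _) v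
  have h2 := tmap_comp_apply (E := E) (E' := E) (E'' := F) (g := f)
    (f := fun x : G => g⁻¹ * x) (x := g) (inv_mul_cancel g) (hd _)
    (mdifferentiable_mul_left' E _ _) v
  have e : (fun x => (f g)⁻¹ * f x) = fun x => f (g⁻¹ * x) := by
    funext x
    rw [map_mul, map_inv]
  exact h1.symm.trans ((congrArg (fun T => tmap E F T g v) e).trans h2)

lemma related_rightField (hf : ContMDiff 𝓘(ℝ, E) 𝓘(ℝ, F) ∞ f)
    (X : GroupLieAlgebra 𝓘(ℝ, E) G) :
    Related 𝓘(ℝ, E) 𝓘(ℝ, F) f (rightField X)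
      (rightField (G := K) (tmap E F f 1 X : GroupLieAlgebra 𝓘(ℝ, F) K)) := by
  intro g
  have hd := hf.mdifferentiable (by simp)
  have h1 := tmap_comp_apply (E := E) (E' := F) (E'' := F) (g := fun x : K => x * f g)
    (f := f) (x := 1) (map_one f) (mdifferentiable_mul_right' F _ _) (hd _) X
  have h2 := tmap_comp_apply (E := E) (E' := E) (E'' := F) (g := f)
    (f := fun x : G => x * g) (x := 1) (one_mul g) (hd _)
    (mdifferentiable_mul_right' E _ _) X
  have e : (fun x => f x * f g) = fun x => f (x * g) := by
    funext x
    rw [map_mul]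
  exact (h1.symm.trans ((congrArg (fun T => tmap E F T 1 X) e).trans h2)).symm

/-- The kernel is a Lie ideal. With h the chart of `K` at 1 composed with `f`, the derivative of h
along the left invariant field of `v` is a function of `f y` alone, so differentiating it along `w`
gives 0. Along the field of `w` the derivative of h vanishes near 1. The commutator formula then has
two zero terms. -/
lemma tmap_mlieBracket_leftField_eq_zero (hf : ContMDiff 𝓘(ℝ, E) 𝓘(ℝ, F) ∞ f)
    (v : E) {w : E} (hw : tmap E F f 1 w = 0) :
    tmap E F f 1 (VectorField.mlieBracket 𝓘(ℝ, E) (leftField v : Π _ : G, _) (leftField w) 1)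
      = 0 := by
  have hd := hf.mdifferentiable (by simp)
  have hf1 : f 1 = 1 := map_one f
  have hs : ∀ᶠ y in 𝓝 (1 : G), f y ∈ (chartAt F (1 : K)).source :=
    (hf 1).continuousAt.preimage_mem_nhds
      (hf1.symm ▸ (chartAt F (1 : K)).open_source.mem_nhds (mem_chart_source F (1 : K)))
  have hh : ContMDiffAt 𝓘(ℝ, E) 𝓘(ℝ, F) ∞ (fun y => chartAt F (1 : K) (f y)) 1 :=
    ContMDiffAt.comp_of_eq (contMDiffAt_of_mem_maximalAtlas
      (IsManifold.chart_mem_maximalAtlas (1 : K)) (mem_chart_source F (1 : K))) (hf 1) hf1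
  have hc : ∀ u : E, (fun y => tmap E F (fun y => chartAt F (1 : K) (f y)) y
      (leftField (F := E) u y : E)) =ᶠ[𝓝 (1 : G)]
      fun y => toCoord F 1 (f y) (leftTrans F (f y) (tmap E F f 1 u)) := fun u => by
    filter_upwards [hs] with y hy
    have h := tmap_comp_apply (E := E) (E' := F) (E'' := F) (g := chartAt F (1 : K)) (f := f)
      (x := y) rfl (mdifferentiableAt_chart hy) (hd y) (leftTrans E y u)
    rw [tmap_leftTrans_of_leftForm (leftForm_tmap_hom hf)] at h
    rw [toCoord_eq_tmap hy]
    exact h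
  have h1 := tmap_mlieBracket hh (smoothField_leftField v) (smoothField_leftField w)
  have hq : MDifferentiableAt 𝓘(ℝ, F) 𝓘(ℝ, F)
      (fun k => toCoord F 1 k (leftTrans F k (tmap E F f 1 v))) (1 : K) :=
    ((contMDiffAt_leftTrans (1 : K)).clm_apply contMDiffAt_const).mdifferentiableAt (by simp)
  have hw' : (leftField w (1 : G) : E) = w := congrArg (fun L : E →L[ℝ] E => L w) leftTrans_one
  have h2 : tmap E F (fun y => tmap E F (fun y => chartAt F (1 : K) (f y)) y
      (leftField (F := E) v y : E)) (1 : G) w = 0 := by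
    rw [tmap_congr (hc v), tmap_comp_apply (E' := F)
      (g := fun k => toCoord F 1 k (leftTrans F k (tmap E F f 1 v))) hf1 hq (hd 1), hw, map_zero]
  have h3 : tmap E F (fun y => tmap E F (fun y => chartAt F (1 : K) (f y)) y
      (leftField (F := E) w y : E)) (1 : G) = 0 := by
    rw [tmap_congr (hc w), hw]
    simp only [map_zero]
    exact tmap_const _ _
  have h4 := tmap_comp_apply (E := E) (E' := F) (E'' := F) (g := chartAt F (1 : K)) (f := f)
    (x := 1) hf1 (mdifferentiableAt_chart (mem_chart_source F (1 : K))) (hd 1)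
    (VectorField.mlieBracket 𝓘(ℝ, E) (leftField v : Π _ : G, _) (leftField w) 1)
  rw [tmap_chart_self] at h4
  refine Eq.trans (α := F) h4.symm (h1.trans ?_)
  refine (congrArg₂ (fun a b : F => a - b) (congrArg (fun L : E →L[ℝ] F => L _) h3)
    ((congrArg (tmap E F _ (1 : G)) hw').trans h2)).trans ?_
  exact sub_zero _

variable [FiniteDimensional ℝ E]

/-- Right invariant fields are `f`-related to right invariant fields, so the first term of
`starProd_eq` passes to `K`; it vanishes when the differential kills `X`. -/
lemma tmap_starProd (hf : ContMDiff 𝓘(ℝ, E) 𝓘(ℝ, F) ∞ f)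
    {D : Connection 𝓘(ℝ, E) G} (hD : D.IsLeftInvariant)
    (X Y : GroupLieAlgebra 𝓘(ℝ, E) G) :
    tmap E F f 1 (starProd D X Y)
      = tmap F F (leftCoord (rightField (G := K) (tmap E F f 1 Y : GroupLieAlgebra 𝓘(ℝ, F) K)))
          (1 : K) (tmap E F f 1 X)
        + tmap E F f 1 (leftProd D X Y) := by
  have h := tmap_leftCoord_of_related hf (leftForm_tmap_hom hf) (smoothField_rightField Y)
    (smoothField_rightField _) (related_rightField hf Y) 1 X
  rw [map_one] at h
  refine (congrArg (tmap E F f 1) (starProd_eq hD X Y)).trans ?_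
  rw [map_add, h]

/-- The kernel of the derivative of the homomorphism is a two sided ideal for the product of left
invariant fields if it is a right ideal for the product of right invariant fields. -/
lemma tmap_leftProd_eq_zero (hf : ContMDiff 𝓘(ℝ, E) 𝓘(ℝ, F) ∞ f)
    {D : Connection 𝓘(ℝ, E) G} (hD : D.IsLeftInvariant)
    (hstar : ∀ X : GroupLieAlgebra 𝓘(ℝ, E) G, tmap E F f 1 X = 0 →
      ∀ Y, tmap E F f 1 (starProd D X Y) = 0) {v : E} (hv : tmap E F f 1 v = 0) (w : E) :
    tmap E F f 1 (leftProd D v w) = 0 := by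
  have h := tmap_starProd hf hD v w
  rw [hstar v hv w, hv, map_zero, zero_add] at h
  exact h.symm

/-- Vanishing torsion says that exchanging the factors costs only the bracket of the left invariant
fields, which lies in the kernel because the kernel is a Lie ideal. -/
lemma tmap_leftProd_eq_zero' (hf : ContMDiff 𝓘(ℝ, E) 𝓘(ℝ, F) ∞ f)
    {D : Connection 𝓘(ℝ, E) G} (hD : D.IsLeftInvariant)
    (htors : D.IsTorsionFree)
    (hstar : ∀ X : GroupLieAlgebra 𝓘(ℝ, E) G, tmap E F f 1 X = 0 →
      ∀ Y, tmap E F f 1 (starProd D X Y) = 0) (v : E) {w : E} (hw : tmap E F f 1 w = 0) :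
    tmap E F f 1 (leftProd D v w) = 0 := by
  have h := htors _ _ (smoothField_leftField v) (smoothField_leftField w) 1
  let Z : E := VectorField.mlieBracket 𝓘(ℝ, E) (leftField v : Π _ : G, _) (leftField w) 1
  have hZ : tmap E F f 1 Z = 0 := tmap_mlieBracket_leftField_eq_zero hf v hw
  have h' : leftProd D v w = leftProd D w v + Z := by
    rw [leftProd_apply, leftProd_apply]
    exact sub_eq_iff_eq_add'.1 (sub_eq_zero.1 h)
  rw [h', map_add, tmap_leftProd_eq_zero hf hD hstar hw, hZ, add_zero]

end Homomorphism

/-! ### Linear sections and complements of a kernel. -/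

section LinearAlgebra

variable {E : Type*} [NormedAddCommGroup E] [NormedSpace ℝ E]
  {F : Type*} [NormedAddCommGroup F] [NormedSpace ℝ F]

/-- The bilinear product induced on the target of `p` by a linear section `s`. -/
noncomputable def pushProd (p : E →L[ℝ] F) (s : F →L[ℝ] E) (C : E →L[ℝ] E →L[ℝ] E) :
    F →L[ℝ] F →L[ℝ] F :=
  (ContinuousLinearMap.compL ℝ F E F p).comp (C.bilinearComp s s)

lemma map_projectionOnto {p : E →L[ℝ] F} {m h : Submodule ℝ E} (hmh : IsCompl m h)
    (hh : ∀ x, x ∈ h ↔ p x = 0) (x : E) : p (m.projectionOnto h hmh x) = p x := by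
  have h1 : m.projectionOnto h hmh (m.projectionOnto h hmh x - x) = 0 := by
    rw [map_sub, Submodule.projectionOnto_apply_left, sub_self]
  have h2 := (hh _).1 ((Submodule.projectionOnto_apply_eq_zero_iff hmh).1 h1)
  rwa [map_sub, sub_eq_zero] at h2

variable [FiniteDimensional ℝ F]

lemma exists_rightInverse_of_surjective {p : E →L[ℝ] F} (hp : Function.Surjective p) :
    ∃ s : F →L[ℝ] E, ∀ u, p (s u) = u := by
  obtain ⟨s, hs⟩ := (p : E →ₗ[ℝ] F).exists_rightInverse_of_surjective (LinearMap.range_eq_top.2 hp)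
  exact ⟨LinearMap.toContinuousLinearMap s, fun u => congrArg (fun L : F →ₗ[ℝ] F => L u) hs⟩

/-- As `h` is the kernel, `p` restricts to a bijection on `m`; the section is its inverse. -/
lemma exists_rightInverse_of_isCompl {p : E →L[ℝ] F} (hp : Function.Surjective p)
    {m h : Submodule ℝ E} (hmh : IsCompl m h) (hh : ∀ x, x ∈ h ↔ p x = 0) :
    ∃ s : F →L[ℝ] E, (∀ u, p (s u) = u) ∧ (∀ x ∈ m, s (p x) = x) ∧ ∀ u, s u ∈ m := by
  let q : m →ₗ[ℝ] F := (p : E →ₗ[ℝ] F) ∘ₗ m.subtype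
  have hq : Function.Bijective q := by
    constructor
    · rw [injective_iff_map_eq_zero]
      intro x hx
      exact Subtype.ext (Submodule.disjoint_def.1 hmh.disjoint x x.2 ((hh x).2 hx))
    · intro u
      obtain ⟨x, rfl⟩ := hp u
      obtain ⟨y, hy, z, hz, rfl⟩ := Submodule.mem_sup.1
        (hmh.sup_eq_top ▸ Submodule.mem_top : x ∈ m ⊔ h)
      refine ⟨⟨y, hy⟩, ?_⟩
      rw [map_add, (hh z).1 hz, add_zero]
      rfl
  let e := LinearEquiv.ofBijective q hq
  refine ⟨LinearMap.toContinuousLinearMap (m.subtype ∘ₗ e.symm.toLinearMap),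
    fun u => e.apply_symm_apply u, fun x hx => ?_, fun u => (e.symm u).2⟩
  exact congrArg Subtype.val (e.symm_apply_apply ⟨x, hx⟩)

end LinearAlgebra

/-! ### Data that determine a connection on a Lie group. -/

section Uniqueness

variable {F : Type*} [NormedAddCommGroup F] [NormedSpace ℝ F] [FiniteDimensional ℝ F]
  {K : Type*} [TopologicalSpace K] [ChartedSpace F K] [Group K] [LieGroup 𝓘(ℝ, F) ∞ K]

lemma Connection.agree_of_rightField {D D' : Connection 𝓘(ℝ, F) K}
    (h : ∀ v w : GroupLieAlgebra 𝓘(ℝ, F) K, ∀ k : K,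
      D.nabla (rightField v) (rightField w) k = D'.nabla (rightField v) (rightField w) k) :
    D.Agree D' := by
  intro X Y _ hY
  funext k
  obtain ⟨w, hw⟩ := rightField_surjective (F := F) k (Y k)
  refine congrArg (fun L : F →L[ℝ] F => L (X k))
    (Connection.apply_eq_of_apply_eq hY (smoothField_rightField w) hw.symm ?_)
  refine ContinuousLinearMap.ext fun (v : F) => ?_
  obtain ⟨u, rfl⟩ := rightField_surjective k v
  exact h u w k

lemma Connection.IsLeftInvariant.agree_of_starProd {D D' : Connection 𝓘(ℝ, F) K}
    (hD : D.IsLeftInvariant) (hD' : D'.IsLeftInvariant)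
    (h : ∀ v w : GroupLieAlgebra 𝓘(ℝ, F) K, starProd D v w = starProd D' v w) : D.Agree D' := by
  have hC : leftProd D = leftProd D' := by
    ext v w
    have h1 := starProd_eq hD v w
    have h2 := starProd_eq hD' v w
    exact add_left_cancel (h1.symm.trans ((h v w).trans h2))
  intro X Y hX hY
  rw [hD.agree_leftConn X Y hX hY, hD'.agree_leftConn X Y hX hY, hC]

end Uniqueness

/-! ### Projected fields as right invariant fields of the quotient. -/

section ProjectedField

variable {E : Type*} [NormedAddCommGroup E] [NormedSpace ℝ E]
  {G : Type*} [TopologicalSpace G] [ChartedSpace E G] [Group G] {H : Subgroup G} [H.Normal]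
  {F : Type*} [NormedAddCommGroup F] [NormedSpace ℝ F]
  [ChartedSpace F (G ⧸ H)] [LieGroup 𝓘(ℝ, F) ∞ (G ⧸ H)]

/-- An element g acts on the quotient group as multiplication by π(g) on the left. -/
lemma projField_eq (hπ : IsSubmersion 𝓘(ℝ, E) 𝓘(ℝ, F) ∞ (fun x : G => (x : G ⧸ H)))
    (X : GroupLieAlgebra 𝓘(ℝ, E) G) :
    (projField 𝓘(ℝ, F) X : Π x : G ⧸ H, TangentSpace 𝓘(ℝ, F) x) =
      rightField (G := G ⧸ H)
        (tmap E F (QuotientGroup.mk' H) 1 X : GroupLieAlgebra 𝓘(ℝ, F) (G ⧸ H)) := by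
  funext x
  exact tmap_comp_apply (E := E) (E' := F) (E'' := F) (g := fun y : G ⧸ H => y * x)
    (f := QuotientGroup.mk' H) (x := 1) (map_one _) (mdifferentiable_mul_right' F x _)
    (hπ.contMDiff.mdifferentiable (by simp) 1) X

lemma nabla_projField (hπ : IsSubmersion 𝓘(ℝ, E) 𝓘(ℝ, F) ∞ (fun x : G => (x : G ⧸ H)))
    (D : Connection 𝓘(ℝ, F) (G ⧸ H)) (X Y : GroupLieAlgebra 𝓘(ℝ, E) G) :
    D.nabla (projField 𝓘(ℝ, F) X) (projField 𝓘(ℝ, F) Y) =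
      D.nabla (rightField (G := G ⧸ H)
        (tmap E F (QuotientGroup.mk' H) 1 X : GroupLieAlgebra 𝓘(ℝ, F) (G ⧸ H)))
        (rightField (G := G ⧸ H)
        (tmap E F (QuotientGroup.mk' H) 1 Y : GroupLieAlgebra 𝓘(ℝ, F) (G ⧸ H))) := by
  rw [projField_eq hπ, projField_eq hπ]

end ProjectedField

/-! ### The quotient Lie group and its induced connections. -/

section Quotient

variable {E : Type*} [NormedAddCommGroup E] [NormedSpace ℝ E]
  {G : Type*} [TopologicalSpace G] [ChartedSpace E G] [Group G] [LieGroup 𝓘(ℝ, E) ∞ G]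
  {H : Subgroup G} [H.Normal]
  {F : Type*} [NormedAddCommGroup F] [NormedSpace ℝ F]
  [ChartedSpace F (G ⧸ H)]

/-- Locally, multiplication is the projection of the product of two smooth local sections; inversion
is smooth because it is so after composition with the submersion. -/
lemma quotient_lieGroup [IsManifold 𝓘(ℝ, F) ∞ (G ⧸ H)]
    (hπ : IsSubmersion 𝓘(ℝ, E) 𝓘(ℝ, F) ∞ (fun x : G => (x : G ⧸ H))) :
    LieGroup 𝓘(ℝ, F) ∞ (G ⧸ H) where
  contMDiff_mul := by
    rintro ⟨a, b⟩
    obtain ⟨a, rfl⟩ := QuotientGroup.mk_surjective a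
    obtain ⟨b, rfl⟩ := QuotientGroup.mk_surjective b
    obtain ⟨s, hs, -, hfs⟩ := exists_localSection (hπ.isSubmersionAt a)
    obtain ⟨t, ht, -, hft⟩ := exists_localSection (hπ.isSubmersionAt b)
    have h : ContMDiffAt (𝓘(ℝ, F).prod 𝓘(ℝ, F)) 𝓘(ℝ, F) ∞
        (fun q : (G ⧸ H) × (G ⧸ H) => ((s q.1 * t q.2 : G) : G ⧸ H)) ((a : G ⧸ H), (b : G ⧸ H)) :=
      hπ.contMDiff.contMDiffAt.comp ((a : G ⧸ H), (b : G ⧸ H))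
        ((hs.comp ((a : G ⧸ H), (b : G ⧸ H)) contMDiffAt_fst).mul
          (ht.comp ((a : G ⧸ H), (b : G ⧸ H)) contMDiffAt_snd))
    refine h.congr_of_eventuallyEq ?_
    filter_upwards [continuousAt_fst.eventually hfs, continuousAt_snd.eventually hft] with q h1 h2
    exact (congrArg₂ (· * ·) h1 h2).symm
  contMDiff_inv := by
    intro a
    obtain ⟨a, rfl⟩ := QuotientGroup.mk_surjective a
    refine contMDiffAt_of_comp_submersion (hπ.isSubmersionAt a) ?_
    exact hπ.contMDiff.contMDiffAt.comp a (contMDiff_inv 𝓘(ℝ, E) ∞).contMDiffAt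

/-- A curve in `H` projects to a point; conversely, a kernel vector is tangent to a curve in the
fiber through 1, which is `H`. -/
lemma mem_subLie_iff (hπ : IsSubmersion 𝓘(ℝ, E) 𝓘(ℝ, F) ∞ (fun x : G => (x : G ⧸ H)))
    (v : GroupLieAlgebra 𝓘(ℝ, E) G) :
    v ∈ subLie 𝓘(ℝ, E) H ↔ tmap E F (QuotientGroup.mk' H) 1 v = 0 := by
  constructor
  · rintro ⟨γ, hγ, hγH, hγ0, rfl⟩
    have h := tmap_comp_apply (E := ℝ) (E' := E) (E'' := F) (g := QuotientGroup.mk' H) (f := γ)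
      (x := 0) hγ0 (hπ.contMDiff.mdifferentiable (by simp) 1) (hγ.mdifferentiable (by simp) 0) 1
    have e : (fun t => QuotientGroup.mk' H (γ t)) = fun _ => 1 :=
      funext fun t => (QuotientGroup.eq_one_iff _).2 (hγH t)
    rw [e, tmap_const] at h
    exact h.symm
  · intro hv
    obtain ⟨γ, hγ, hγf, hγ0, hγv⟩ := exists_curve_of_tmap_eq_zero (hπ.isSubmersionAt 1) hv
    exact ⟨γ, hγ, fun t => (QuotientGroup.eq_one_iff _).1 (hγf t), hγ0, hγv⟩

variable [LieGroup 𝓘(ℝ, F) ∞ (G ⧸ H)]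

lemma Connection.IsLeftInvariant.isInvariantUnder {D : Connection 𝓘(ℝ, F) (G ⧸ H)}
    (hD : D.IsLeftInvariant) : D.IsInvariantUnder (G ⧸ H) G :=
  fun g => hD (g : G ⧸ H)

lemma Connection.IsInvariantUnder.isLeftInvariant {D : Connection 𝓘(ℝ, F) (G ⧸ H)}
    (hD : D.IsInvariantUnder (G ⧸ H) G) : D.IsLeftInvariant := by
  intro k
  obtain ⟨g, rfl⟩ := QuotientGroup.mk_surjective k
  exact hD g

variable [FiniteDimensional ℝ E]

lemma inducedAt_leftConn (hπ : IsSubmersion 𝓘(ℝ, E) 𝓘(ℝ, F) ∞ (fun x : G => (x : G ⧸ H)))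
    {D : Connection 𝓘(ℝ, E) G} (hD : D.IsLeftInvariant) {s : F →L[ℝ] E}
    {X Y : GroupLieAlgebra 𝓘(ℝ, E) G} {g : G}
    (hC : tmap E F (QuotientGroup.mk' H) 1 (leftProd D
        (s (tmap E F (QuotientGroup.mk' H) 1 (adjoint (I := 𝓘(ℝ, E)) g⁻¹ X)))
        (s (tmap E F (QuotientGroup.mk' H) 1 (adjoint (I := 𝓘(ℝ, E)) g⁻¹ Y))))
      = tmap E F (QuotientGroup.mk' H) 1 (leftProd D
        (adjoint (I := 𝓘(ℝ, E)) g⁻¹ X) (adjoint (I := 𝓘(ℝ, E)) g⁻¹ Y))) :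
    InducedAt D (leftConn (pushProd (tmap E F (QuotientGroup.mk' H) 1) s (leftProd D)) :
      Connection 𝓘(ℝ, F) (G ⧸ H)) X Y g := by
  have hf : ContMDiff 𝓘(ℝ, E) 𝓘(ℝ, F) ∞ (QuotientGroup.mk' H) := hπ.contMDiff
  rw [InducedAt, nabla_projField hπ,
    hD.agree_leftConn _ _ (smoothField_rightField X) (smoothField_rightField Y)]
  refine (leftConn_nabla_of_related hf (leftForm_tmap_hom hf) (smoothField_rightField Y)
    (smoothField_rightField _) (related_rightField hf X) (related_rightField hf Y) g ?_).symm
  rw [leftCoord_rightField, leftCoord_rightField]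
  exact hC

lemma isAffineMap_mk_leftConn
    (hπ : IsSubmersion 𝓘(ℝ, E) 𝓘(ℝ, F) ∞ (fun x : G => (x : G ⧸ H)))
    {D : Connection 𝓘(ℝ, E) G} (hD : D.IsLeftInvariant) {s : F →L[ℝ] E}
    (hC : ∀ v w, tmap E F (QuotientGroup.mk' H) 1 (leftProd D
        (s (tmap E F (QuotientGroup.mk' H) 1 v)) (s (tmap E F (QuotientGroup.mk' H) 1 w)))
      = tmap E F (QuotientGroup.mk' H) 1 (leftProd D v w)) :
    IsAffineMap D (leftConn (pushProd (tmap E F (QuotientGroup.mk' H) 1) s (leftProd D)) :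
      Connection 𝓘(ℝ, F) (G ⧸ H)) (fun x : G => (x : G ⧸ H)) := by
  have hf : ContMDiff 𝓘(ℝ, E) 𝓘(ℝ, F) ∞ (QuotientGroup.mk' H) := hπ.contMDiff
  refine ⟨hf, fun X Y X' Y' hX hY _ hY' hXX' hYY' g => ?_⟩
  rw [hD.agree_leftConn X Y hX hY]
  exact leftConn_nabla_of_related hf (leftForm_tmap_hom hf) hY hY' hXX' hYY' g (hC _ _)

end Quotient

end AffineLie

/-! ### The ideal case and the reductive case. -/

theorem mainTheorem11
    {E : Type*} [NormedAddCommGroup E] [NormedSpace ℝ E] [FiniteDimensional ℝ E]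
    {G : Type*} [TopologicalSpace G] [ChartedSpace E G] [Group G] [LieGroup 𝓘(ℝ, E) ∞ G]
    (H : Subgroup G) [H.Normal] (hH : IsClosed (H : Set G))
    {F : Type*} [NormedAddCommGroup F] [NormedSpace ℝ F] [FiniteDimensional ℝ F]
    [ChartedSpace F (G ⧸ H)] [IsManifold 𝓘(ℝ, F) ∞ (G ⧸ H)]
    (hπ : IsSubmersion 𝓘(ℝ, E) 𝓘(ℝ, F) ∞ (fun x : G => (x : G ⧸ H)))
    (D : Connection 𝓘(ℝ, E) G) (hD : D.IsSmooth) (hflat : D.IsFlatAffine)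
    (hleft : D.IsLeftInvariant)
    (hright : ∀ h ∈ H, IsAffineMap D D (fun x : G => x * h)) :
    LieGroup 𝓘(ℝ, F) ∞ (G ⧸ H) ∧
    (IsStarRightIdeal D (subLie 𝓘(ℝ, E) H) →
      ∃ D' : Connection 𝓘(ℝ, F) (G ⧸ H), D'.IsSmooth ∧
        (∀ X Y : GroupLieAlgebra 𝓘(ℝ, E) G, ∀ g : G, InducedAt D D' X Y g) ∧
        (∀ D'' : Connection 𝓘(ℝ, F) (G ⧸ H), D''.IsSmooth →
          (∀ X Y : GroupLieAlgebra 𝓘(ℝ, E) G, ∀ g : G, InducedAt D D'' X Y g) → D''.Agree D') ∧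
        D'.IsInvariantUnder (G ⧸ H) G ∧
        IsAffineMap D D' (fun x : G => (x : G ⧸ H)) ∧
        D'.IsLeftInvariant) ∧
    (∀ (m : Submodule ℝ (GroupLieAlgebra 𝓘(ℝ, E) G))
      (hm : IsReductiveComplement 𝓘(ℝ, E) H m),
      ∃ D' : Connection 𝓘(ℝ, F) (G ⧸ H), D'.IsSmooth ∧
        D'.IsInvariantUnder (G ⧸ H) G ∧ HasReductiveProd D hm D' ∧
        (∀ D'' : Connection 𝓘(ℝ, F) (G ⧸ H), D''.IsSmooth →
          D''.IsInvariantUnder (G ⧸ H) G → HasReductiveProd D hm D'' → D''.Agree D') ∧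
        (∀ g : G, (∀ Z ∈ m, adjoint (I := 𝓘(ℝ, E)) g⁻¹ Z ∈ m) →
          ∀ X ∈ m, ∀ Y ∈ m, InducedAt D D' X Y g) ∧
        D'.IsLeftInvariant) := by
  have hK : LieGroup 𝓘(ℝ, F) ∞ (G ⧸ H) := quotient_lieGroup hπ
  have hf : ContMDiff 𝓘(ℝ, E) 𝓘(ℝ, F) ∞ (QuotientGroup.mk' H) := hπ.contMDiff
  set p : E →L[ℝ] F := tmap E F (QuotientGroup.mk' H) 1
  have hps : Function.Surjective p := tmap_surjective_of_submersion (hπ.isSubmersionAt 1)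
  have hker : ∀ v : GroupLieAlgebra 𝓘(ℝ, E) G, v ∈ subLie 𝓘(ℝ, E) H ↔ p v = 0 :=
    mem_subLie_iff hπ
  refine ⟨hK, fun hstar => ?_, fun m hm => ?_⟩
  · obtain ⟨s, hs⟩ := exists_rightInverse_of_surjective hps
    have hstar' : ∀ X : GroupLieAlgebra 𝓘(ℝ, E) G, p X = 0 → ∀ Y, p (starProd D X Y) = 0 :=
      fun X hX Y => (hker _).1 (hstar X ((hker X).2 hX) Y)
    -- The arguments are changed modulo the kernel one at a time: the first by the right ideal
    -- property, the second by the left ideal property that torsion-freeness supplies.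
    have hC : ∀ v w : E, p (leftProd D (s (p v)) (s (p w))) = p (leftProd D v w) := by
      intro v w
      have h1 : p (s (p v) - v) = 0 := by rw [map_sub, hs, sub_self]
      have h2 : p (s (p w) - w) = 0 := by rw [map_sub, hs, sub_self]
      have e1 := tmap_leftProd_eq_zero hf hleft hstar' h1 (s (p w))
      have e2 := tmap_leftProd_eq_zero' hf hleft hflat.1 hstar' v h2
      rw [map_sub, sub_apply, map_sub, sub_eq_zero] at e1
      rw [map_sub, map_sub, sub_eq_zero] at e2
      exact e1.trans e2
    have hI : ∀ X Y : GroupLieAlgebra 𝓘(ℝ, E) G, ∀ g : G,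
        InducedAt D (leftConn (pushProd p s (leftProd D)) : Connection 𝓘(ℝ, F) (G ⧸ H)) X Y g :=
      fun X Y g => inducedAt_leftConn hπ hleft (hC _ _)
    refine ⟨leftConn (pushProd p s (leftProd D)), leftConn_isSmooth _, hI, fun D'' _ hD'' => ?_,
      (leftConn_isLeftInvariant _).isInvariantUnder, isAffineMap_mk_leftConn hπ hleft hC,
      leftConn_isLeftInvariant _⟩
    refine Connection.agree_of_rightField fun v w k => ?_
    obtain ⟨g, rfl⟩ := QuotientGroup.mk_surjective k
    obtain ⟨X, rfl⟩ := hps v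
    obtain ⟨Y, rfl⟩ := hps w
    exact (congrFun (nabla_projField hπ D'' X Y) g).symm.trans (((hD'' X Y g).trans
      (hI X Y g).symm).trans (congrFun (nabla_projField hπ _ X Y) g))
  · obtain ⟨s, hs, hsm, hsm'⟩ := exists_rightInverse_of_isCompl hps (m := m) hm.isCompl hker
    have hI : ∀ g : G, (∀ Z ∈ m, adjoint (I := 𝓘(ℝ, E)) g⁻¹ Z ∈ m) →
        ∀ X ∈ m, ∀ Y ∈ m, InducedAt D (leftConn (pushProd p s (leftProd D)) :
          Connection 𝓘(ℝ, F) (G ⧸ H)) X Y g := by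
      intro g hg X hX Y hY
      refine inducedAt_leftConn hπ hleft ?_
      -- The left components at `g` lie in `m`, where `s` undoes `p`.
      have h1 := hsm _ (hg X hX)
      have h2 := hsm _ (hg Y hY)
      exact congrArg₂ (fun a b : E => p (leftProd D a b)) h1 h2
    have hproj : ∀ X Y : m, p (reductiveProd D hm X Y : GroupLieAlgebra 𝓘(ℝ, E) G)
        = p (starProd D X Y) := fun X Y =>
      map_projectionOnto (E := E) (m := m) (h := subLie 𝓘(ℝ, E) H) hm.isCompl hker (starProd D X Y)
    have h1 : ∀ Z : GroupLieAlgebra 𝓘(ℝ, E) G, adjoint (I := 𝓘(ℝ, E)) (1 : G)⁻¹ Z = Z := fun Z =>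
      (leftCoord_rightField (F := E) Z 1).symm.trans (leftCoord_rightField_one (F := E) Z)
    have hR : HasReductiveProd D hm (leftConn (pushProd p s (leftProd D)) :
        Connection 𝓘(ℝ, F) (G ⧸ H)) := fun X Y =>
      (hI 1 (fun Z hZ => (h1 Z).symm ▸ hZ) X X.2 Y Y.2).trans (hproj X Y).symm
    refine ⟨leftConn (pushProd p s (leftProd D)), leftConn_isSmooth _,
      (leftConn_isLeftInvariant _).isInvariantUnder, hR, fun D'' _ hD'' hR'' => ?_, hI,
      leftConn_isLeftInvariant _⟩
    -- The products are compared only at the identity coset, where `p` maps `m` onto the tangent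
    -- space.
    refine hD''.isLeftInvariant.agree_of_starProd (leftConn_isLeftInvariant _) fun v w => ?_
    obtain ⟨X, hX, rfl⟩ : ∃ X ∈ m, (p X : F) = v := ⟨s v, hsm' v, hs v⟩
    obtain ⟨Y, hY, rfl⟩ : ∃ Y ∈ m, (p Y : F) = w := ⟨s w, hsm' w, hs w⟩
    exact (congrFun (nabla_projField hπ D'' X Y) 1).symm.trans (((hR'' ⟨X, hX⟩ ⟨Y, hY⟩).trans
      (hR ⟨X, hX⟩ ⟨Y, hY⟩).symm).trans (congrFun (nabla_projField hπ _ X Y) 1))
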